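/- Let $\psi_n,\psi^*_n$ ($n\in\mathbf Z$) be free fermions with $\{\psi_m,\psi^*_n\}=\delta_{m+n,0}$, $\{\psi_m,\psi_n\}=\{\psi^*_m,\psi^*_n\}=0$, acting on the Fock space with charge $p$ vacua $|p\rangle$ ($p\in\mathbf Z$), characterized by $\psi_n|p\rangle=0$ for $n\ge -p$ and $\psi^*_n|p\rangle=0$ for $n\ge p+1$. Put ${:}\psi_m\psi^*_n{:}=\psi_m\psi^*_n-\langle 0|\psi_m\psi^*_n|0\rangle$ and $$J_m=\sum_{n\in\mathbf Z}{:}\psi_{m-n}\psi^*_n{:},\quad L_0=\sum_{n\in\mathbf Z} n\,{:}\psi_{-n}\psi^*_n{:},\quad W_0=\sum_{n\in\mathbf Z} n^2\,{:}\psi_{-n}\psi^*_n{:},\quad G_\pm(x)=\exp\Big(\sum_{k\ge1}\frac{x^{k/2}}{k(1-x^k)}J_{\pm k}\Big).$$ Let $0<q<1$, let $N_1,N_2$ be positive integers, $q_1=q^{1/N_1}$, $q_2=q^{1/N_2}$, and let $Q>0$ with $Q\sqrt{q_1q_2}<1$. Then all matrix elements (in the basis of excited states) of $$g=q_1^{W_0/2}G_-(q_1)G_+(q_1)\,Q^{L_0}\,G_-(q_2)G_+(q_2)q_2^{W_0/2}$$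 are given by convergent sums, and for all $k\ge1$ $$(-1)^{N_1k}J_{N_1k}\,g=g\,(-1)^{N_2k}J_{-N_2k}.$$ Consequently, for every $p\in\mathbf Z$ the Toda tau function $$\tau(\boldsymbol T,\bar{\boldsymbol T},p)=\langle p|\exp\Big(\sum_{k\ge1}T_kJ_k\Big)\,g\,\exp\Big(-\sum_{k\ge1}\bar T_kJ_{-k}\Big)|p\rangle,$$ a well-defined formal power series in the times $T_k,\bar T_k$ ($k\ge1$), satisfies the constraints of the (sign-modified) bigraded Toda hierarchy of type $(N_1,N_2)$: $$(-1)^{N_1k}\frac{\partial\tau}{\partial T_{N_1k}}+(-1)^{N_2k}\frac{\partial\tau}{\partial\bar T_{N_2k}}=0\qquad(k\ge1).$$ -/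

import Mathlib

/-! The free fermion Fock space is realised on Maya diagrams (equivalently, semi-infinite wedges):
a Maya diagram is the set of occupied sites of `ℤ`.  The charge `p` excited state `|λ, p⟩`
attached to a partition `λ` is the Maya diagram `{p + λ_i - i + 1 | i ≥ 1}`. -/

/-- A Maya diagram: a set of integers that differs from `{n | n ≤ 0}` by finitely many elements. -/
@[ext] structure Maya where
  carrier : Set ℤ
  finite_particles : (carrier \ Set.Iic 0).Finite
  finite_holes : (Set.Iic 0 \ carrier).Finite

noncomputable section MeltingCrystal

namespace Maya

/-- The charge `p` vacuum `|p⟩`: precisely the sites `n ≤ p` are occupied. -/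
def vac (p : ℤ) : Maya where
  carrier := Set.Iic p
  finite_particles := (Set.finite_Ioc 0 p).subset (fun n hn => by
    simp only [Set.mem_sdiff, Set.mem_Iic, Set.mem_Ioc] at *; omega)
  finite_holes := (Set.finite_Ioc p 0).subset (fun n hn => by
    simp only [Set.mem_sdiff, Set.mem_Iic, Set.mem_Ioc] at *; omega)

/-- Occupy the site `n`. -/
def fill (S : Maya) (n : ℤ) : Maya where
  carrier := insert n S.carrier
  finite_particles := (S.finite_particles.union (Set.finite_singleton n)).subset (by
    rintro x ⟨rfl | hx, h⟩
    · exact Or.inr rfl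
    · exact Or.inl ⟨hx, h⟩)
  finite_holes := S.finite_holes.subset (fun _ hx => ⟨hx.1, fun h => hx.2 (Or.inr h)⟩)

/-- Empty the site `n`. -/
def clear (S : Maya) (n : ℤ) : Maya where
  carrier := S.carrier \ {n}
  finite_particles := S.finite_particles.subset (fun _ hx => ⟨hx.1.1, hx.2⟩)
  finite_holes := (S.finite_holes.union (Set.finite_singleton n)).subset (by
    rintro x ⟨hx, h⟩
    by_cases hn : x = n
    · exact Or.inr hn
    · exact Or.inl ⟨hx, fun h' => h ⟨h', hn⟩⟩)

/-- The sign `(-1)^{number of occupied sites above n}`. -/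
def sign (S : Maya) (n : ℤ) : ℝ := (-1) ^ (S.carrier ∩ Set.Ioi n).ncard

end Maya

/-- The Fock space, with basis the Maya diagrams. -/
abbrev Fock : Type := Maya →₀ ℝ

open Classical in
/-- The creation operator at site `n` (exterior multiplication from the left). -/
def create (n : ℤ) : Fock →ₗ[ℝ] Fock :=
  Finsupp.linearCombination ℝ fun S : Maya =>
    if n ∈ S.carrier then (0 : Fock) else Finsupp.single (S.fill n) (S.sign n)

open Classical in
/-- The annihilation operator at site `n` (contraction from the left). -/
def annihilate (n : ℤ) : Fock →ₗ[ℝ] Fock :=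
  Finsupp.linearCombination ℝ fun S : Maya =>
    if n ∈ S.carrier then Finsupp.single (S.clear n) (S.sign n) else (0 : Fock)

/-- The mode `ψ_n` of the field `ψ(z) = ∑ ψ_n z^{-n-1}`. -/
def psi (n : ℤ) : Fock →ₗ[ℝ] Fock := create (-n)

/-- The mode `ψ*_n` of the field `ψ*(z) = ∑ ψ*_n z^{-n}`. -/
def psiStar (n : ℤ) : Fock →ₗ[ℝ] Fock := annihilate n

/-- `⟨0|A|0⟩`. -/
def vev (A : Fock →ₗ[ℝ] Fock) : ℝ := A (Finsupp.single (Maya.vac 0) 1) (Maya.vac 0)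

/-- The normal ordered product `:ψ_m ψ*_n: = ψ_m ψ*_n - ⟨0|ψ_m ψ*_n|0⟩`. -/
def normalOrd (m n : ℤ) : Fock →ₗ[ℝ] Fock :=
  psi m ∘ₗ psiStar n - vev (psi m ∘ₗ psiStar n) • LinearMap.id

/-- The fermion bilinear `∑_{n ∈ ℤ} c(n) :ψ_{m-n} ψ*_n:`; only finitely many terms of the sum are
nonzero on any given basis vector. -/
def bilinear (c : ℤ → ℝ) (m : ℤ) : Fock →ₗ[ℝ] Fock :=
  Finsupp.linearCombination ℝ fun S : Maya =>
    ∑ᶠ n : ℤ, c n • normalOrd (m - n) n (Finsupp.single S 1)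

/-! Operators such as `G_-` take values in a completion of the Fock space.  Operators are therefore
represented by their infinite matrices of matrix elements `A S U = ⟨S|A|U⟩`, and are composed by
(absolutely convergent) summation over intermediate states.  The entries lie in a topological
`ℝ`-algebra: `ℝ` itself, or formal power series in the Toda times. -/

/-- The matrix elements `⟨S|A|U⟩` of an endomorphism `A` of the Fock space. -/
def matEl (A : Fock →ₗ[ℝ] Fock) : Matrix Maya Maya ℝ :=
  fun S U => A (Finsupp.single U 1) S

/-- `J_m = ∑ :ψ_{m-n} ψ*_n:`. -/
def J (m : ℤ) : Matrix Maya Maya ℝ := matEl (bilinear (fun _ => 1) m)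

/-- `L_0 = ∑ n :ψ_{-n} ψ*_n:`. -/
def L0 : Matrix Maya Maya ℝ := matEl (bilinear (fun n => (n : ℝ)) 0)

/-- `W_0 = ∑ n² :ψ_{-n} ψ*_n:`. -/
def W0 : Matrix Maya Maya ℝ := matEl (bilinear (fun n => (n : ℝ) ^ 2) 0)

section Operators

variable {R : Type*} [CommRing R] [Algebra ℝ R] [TopologicalSpace R]

/-- The composite `A B`, with `⟨S|AB|U⟩ = ∑_T ⟨S|A|T⟩⟨T|B|U⟩`. -/
def opMul (A B : Matrix Maya Maya R) : Matrix Maya Maya R :=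
  fun S U => ∑' T, A S T * B T U

/-- The sums that define the composite `A B` converge. -/
def Composable (A B : Matrix Maya Maya R) : Prop :=
  ∀ S U, Summable fun T => A S T * B T U

open Classical in
/-- The powers `A^n`. -/
def opPow (A : Matrix Maya Maya R) : ℕ → Matrix Maya Maya R
  | 0 => 1
  | n + 1 => opMul A (opPow A n)

/-- `exp A = ∑_n A^n / n!`. -/
def opExp (A : Matrix Maya Maya R) : Matrix Maya Maya R :=
  fun S U => ∑' n : ℕ, ((n.factorial : ℝ)⁻¹) • opPow A n S U

/-- The sums that define `exp A` converge. -/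
def Exponentiable (A : Matrix Maya Maya R) : Prop :=
  (∀ n, Composable A (opPow A n)) ∧
    ∀ S U, Summable fun n : ℕ => ((n.factorial : ℝ)⁻¹) • opPow A n S U

/-- `∑_{k ≥ 1} c(k) J_{ε k}`. -/
def currentSum (c : ℕ+ → R) (ε : ℤ) : Matrix Maya Maya R :=
  fun S U => ∑' k : ℕ+, c k * algebraMap ℝ R (J (ε * (k : ℤ)) S U)

/-- The sum `∑_{k ≥ 1} c(k) J_{ε k}` converges. -/
def CurrentSummable (c : ℕ+ → R) (ε : ℤ) : Prop :=
  ∀ S U, Summable fun k : ℕ+ => c k * algebraMap ℝ R (J (ε * (k : ℤ)) S U)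

end Operators

/-- The coefficients `x^{k/2} / (k (1 - x^k))`. -/
def gCoeff (x : ℝ) (k : ℕ+) : ℝ := x ^ ((k : ℝ) / 2) / ((k : ℝ) * (1 - x ^ (k : ℕ)))

/-- `G_+(x) = exp (∑_{k ≥ 1} x^{k/2} / (k (1 - x^k)) J_k)`. -/
def Gplus (x : ℝ) : Matrix Maya Maya ℝ := opExp (currentSum (gCoeff x) 1)

/-- `G_-(x) = exp (∑_{k ≥ 1} x^{k/2} / (k (1 - x^k)) J_{-k})`. -/
def Gminus (x : ℝ) : Matrix Maya Maya ℝ := opExp (currentSum (gCoeff x) (-1))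

/-- `x^{c A} = exp (c (log x) A)`, for `x > 0`. -/
def opRpow (x c : ℝ) (A : Matrix Maya Maya ℝ) : Matrix Maya Maya ℝ :=
  opExp ((c * Real.log x) • A)

/-- The left part `q₁^{W_0/2} G_-(q₁) G_+(q₁)` of `g`. -/
def gLeft (q₁ : ℝ) : Matrix Maya Maya ℝ :=
  opMul (opRpow q₁ (1 / 2) W0) (opMul (Gminus q₁) (Gplus q₁))

/-- The right part `G_-(q₂) G_+(q₂) q₂^{W_0/2}` of `g`. -/
def gRight (q₂ : ℝ) : Matrix Maya Maya ℝ :=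
  opMul (opMul (Gminus q₂) (Gplus q₂)) (opRpow q₂ (1 / 2) W0)

/-- The element
`g = q₁^{W_0/2} G_-(q₁) G_+(q₁) Q^{L_0} G_-(q₂) G_+(q₂) q₂^{W_0/2}`.
(All factors have nonnegative entries, so that the bracketing is immaterial.) -/
def gElement (q₁ q₂ Q : ℝ) : Matrix Maya Maya ℝ :=
  opMul (opMul (gLeft q₁) (opRpow Q 1 L0)) (gRight q₂)

/-- All the sums that enter the definition of `g` converge. -/
def GElementConverges (q₁ q₂ Q : ℝ) : Prop :=
  (∀ x ∈ ({q₁, q₂} : Set ℝ), ∀ ε ∈ ({1, -1} : Set ℤ),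
      CurrentSummable (gCoeff x) ε ∧ Exponentiable (currentSum (gCoeff x) ε)) ∧
  (∀ x ∈ ({q₁, q₂} : Set ℝ), Exponentiable ((1 / 2 * Real.log x) • W0)) ∧
  Exponentiable ((1 * Real.log Q) • L0) ∧
  (∀ x ∈ ({q₁, q₂} : Set ℝ), Composable (Gminus x) (Gplus x)) ∧
  Composable (opRpow q₁ (1 / 2) W0) (opMul (Gminus q₁) (Gplus q₁)) ∧
  Composable (opMul (Gminus q₂) (Gplus q₂)) (opRpow q₂ (1 / 2) W0) ∧
  Composable (gLeft q₁) (opRpow Q 1 L0) ∧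
  Composable (opMul (gLeft q₁) (opRpow Q 1 L0)) (gRight q₂)

/-- Formal power series in the Toda times `T_k` (index `Sum.inl k`) and `T̄_k` (index
`Sum.inr k`), `k ≥ 1`. -/
abbrev TimeRing : Type := MvPowerSeries (ℕ+ ⊕ ℕ+) ℝ

section Tau

open scoped MvPowerSeries.WithPiTopology

/-- `exp (∑_{k ≥ 1} T_k J_k)`. -/
def timeEvolution : Matrix Maya Maya TimeRing :=
  opExp (currentSum (fun k => (MvPowerSeries.X (Sum.inl k) : TimeRing)) 1)

/-- `exp (- ∑_{k ≥ 1} T̄_k J_{-k})`. -/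
def timeEvolutionBar : Matrix Maya Maya TimeRing :=
  opExp (currentSum (fun k => -(MvPowerSeries.X (Sum.inr k) : TimeRing)) (-1))

/-- The tau function
`τ(T, T̄, p) = ⟨p| exp (∑ T_k J_k) g exp (- ∑ T̄_k J_{-k}) |p⟩`
as a formal power series in the times, for an operator `g`. Infinite sums of formal power series
are taken coefficientwise. -/
def tau (g : Matrix Maya Maya ℝ) (p : ℤ) : TimeRing :=
  opMul timeEvolution (opMul (g.map (algebraMap ℝ TimeRing)) timeEvolutionBar)
    (Maya.vac p) (Maya.vac p)

/-- All the sums that enter the definition of the tau function of `g` converge. -/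
def TauConverges (g : Matrix Maya Maya ℝ) (p : ℤ) : Prop :=
  CurrentSummable (fun k => (MvPowerSeries.X (Sum.inl k) : TimeRing)) 1 ∧
  CurrentSummable (fun k => -(MvPowerSeries.X (Sum.inr k) : TimeRing)) (-1) ∧
  Exponentiable (currentSum (fun k => (MvPowerSeries.X (Sum.inl k) : TimeRing)) 1) ∧
  Exponentiable (currentSum (fun k => -(MvPowerSeries.X (Sum.inr k) : TimeRing)) (-1)) ∧
  (∀ S, Summable fun U => (g.map (algebraMap ℝ TimeRing)) S U *
    timeEvolutionBar U (Maya.vac p)) ∧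
  Summable fun S => timeEvolution (Maya.vac p) S *
    opMul (g.map (algebraMap ℝ TimeRing)) timeEvolutionBar S (Maya.vac p)

end Tau

end MeltingCrystal

/-!
# The melting crystal operator and the bigraded Toda constraints

Write `G = exp (∑_k a_k J_k)` with `a_k = x^{k/2} / (k (1 - x^k))`, so that `G_+ = G` and `G_-` is
the transpose of `G`; the matrix of `G_- G_+` is then the Gram matrix `⟨G e_S, G e_T⟩` (`gram`).

*Shift symmetry.* For fixed `K` put
`V_m = x^{-Km/2} ∑_n x^{Kn} :ψ_{m-n} ψ*_n: - δ_{m,0} x^K/(1-x^K)` (`torus`). The subtracted constant removes the central term from the commutators, which become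
`[J_k, V_m] = (x^{Kk/2} - x^{-Kk/2}) V_{m+k}` (`current_torus_comm`). Conjugation by `G` therefore
multiplies the generating function of the `V_m` by
`exp (∑_k a_k (x^{Kk/2} - x^{-Kk/2}) z^k) = ∏_{i<K} (1 - y_i z)`, `y_i = x^{i + 1/2 - K/2}`, a
polynomial (`vertexOp_torus`). The set of the `y_i` is stable under `y ↦ 1/y`, so this polynomial is
palindromic up to the sign `(-1)^K`; since `V_m` and `V_{-m}` are transposes of each other, this
gives `V_K G_- G_+ = (-1)^K G_- G_+ V_0` (`dot_vertexOp_torus`).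

*The intertwining relation.* Moving `J_K` through `x^{W_0/2}` turns it into the `V_K` above, so
`J_{N₁k} g` carries the diagonal operator `V_0` with `x^K = q₁^{N₁k} = q^k` next to `Q^{L_0}`. The
same happens to `g J_{-N₂k}` from the right, with `q₂^{N₂k} = q^k`, and the two diagonal operators
agree (`J_gElement`).

*Convergence.* The energy takes values in the natural numbers and has finite sublevel sets, and all
operators are homogeneous or triangular with respect to it. Apart from scalar exponential series,
the only infinite sum is thus the one over the intermediate states at `Q^{L_0}`. The correlations
`∑_{|T| = d} G_{RT} G_{UT}` satisfy a linear recursion in `d` (`shellSum_recursion`), by the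
Heisenberg relations, from which they are `O(t^d)` for every `t > x`; a weighted
arithmetic-geometric mean inequality then gives absolute convergence for `Q √(q₁q₂) < 1`
(`summable_vertexOp_mul`).

*The tau function.* The time evolutions satisfy `∂ exp (∑ T_k J_k) / ∂T_K = exp (∑ T_k J_k) J_K`, and
each monomial in the times occurs for finitely many intermediate states only. Derivatives of `τ`
thus insert `J_K` on the left of `g`, or `-J_{-K}` on its right (`pderiv_inl_tau`,
`pderiv_inr_tau`), and the constraints follow from the intertwining relation.
-/

noncomputable section MeltingCrystalProof

open Finsupp

/-- A shortcut instance: the general instance for `Module.End` is found only after unfolding the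
additive structure of `Finsupp`, where rewriting with ring identities does not reach it. -/
instance endFockRing : Ring (Module.End ℝ Fock) := inferInstance

/-! ### Canonical anticommutation relations -/

namespace Maya

@[simp] lemma mem_fill {S : Maya} {n m : ℤ} : m ∈ (S.fill n).carrier ↔ m = n ∨ m ∈ S.carrier :=
  Iff.rfl

@[simp] lemma mem_clear {S : Maya} {n m : ℤ} : m ∈ (S.clear n).carrier ↔ m ∈ S.carrier ∧ m ≠ n :=
  Iff.rfl

@[simp] lemma mem_vac {p m : ℤ} : m ∈ (vac p).carrier ↔ m ≤ p := Iff.rfl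

lemma finite_inter_Ioi (S : Maya) (n : ℤ) : (S.carrier ∩ Set.Ioi n).Finite := by
  refine (S.finite_particles.union (Set.finite_Ioc n 0)).subset ?_
  rintro x ⟨hx, hn⟩
  by_cases h : x ≤ 0
  · exact Or.inr ⟨hn, h⟩
  · exact Or.inl ⟨hx, h⟩

lemma sign_fill_of_lt {S : Maya} {n m : ℤ} (hn : n ∉ S.carrier) (h : m < n) :
    (S.fill n).sign m = -S.sign m := by
  have : (S.fill n).carrier ∩ Set.Ioi m = insert n (S.carrier ∩ Set.Ioi m) := by
    ext x; simp only [Set.mem_inter_iff, mem_fill, Set.mem_Ioi, Set.mem_insert_iff]; grind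
  rw [sign, this, Set.ncard_insert_of_notMem (fun h' => hn h'.1) (S.finite_inter_Ioi m), pow_succ,
    sign]
  ring

lemma sign_fill_of_le {S : Maya} {n m : ℤ} (h : n ≤ m) : (S.fill n).sign m = S.sign m := by
  have : (S.fill n).carrier ∩ Set.Ioi m = S.carrier ∩ Set.Ioi m := by
    ext x; simp only [Set.mem_inter_iff, mem_fill, Set.mem_Ioi]; grind
  rw [sign, this, sign]

lemma fill_clear_self {S : Maya} {n : ℤ} (hn : n ∈ S.carrier) : (S.clear n).fill n = S := by
  ext x; simp only [mem_fill, mem_clear]; grind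

lemma clear_fill_self {S : Maya} {n : ℤ} (hn : n ∉ S.carrier) : (S.fill n).clear n = S := by
  ext x; simp only [mem_fill, mem_clear]; grind

lemma sign_clear_of_lt {S : Maya} {n m : ℤ} (hn : n ∈ S.carrier) (h : m < n) :
    (S.clear n).sign m = -S.sign m := by
  have := sign_fill_of_lt (S := S.clear n) (n := n) (m := m) (by simp) h
  rw [fill_clear_self hn] at this
  rw [this, neg_neg]

lemma sign_clear_of_le {S : Maya} {n m : ℤ} (h : n ≤ m) : (S.clear n).sign m = S.sign m := by
  have : (S.clear n).carrier ∩ Set.Ioi m = S.carrier ∩ Set.Ioi m := by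
    ext x; simp only [Set.mem_inter_iff, mem_clear, Set.mem_Ioi]; grind
  rw [sign, this, sign]

lemma sign_mul_self (S : Maya) (n : ℤ) : S.sign n * S.sign n = 1 := by
  rw [sign, ← mul_pow]; simp

lemma fill_comm (S : Maya) (m n : ℤ) : (S.fill m).fill n = (S.fill n).fill m := by
  ext x; simp only [mem_fill]; tauto

lemma clear_comm (S : Maya) (m n : ℤ) : (S.clear m).clear n = (S.clear n).clear m := by
  ext x; simp only [mem_clear]; tauto

lemma fill_clear_comm (S : Maya) {m n : ℤ} (h : m ≠ n) :
    (S.fill m).clear n = (S.clear n).fill m := by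
  ext x; simp only [mem_clear, mem_fill]; grind

end Maya

open Classical in
lemma create_single (n : ℤ) (S : Maya) (r : ℝ) :
    create n (single S r) = if n ∈ S.carrier then 0 else single (S.fill n) (r * S.sign n) := by
  rw [create, linearCombination_single]; split_ifs <;> simp

open Classical in
lemma annihilate_single (n : ℤ) (S : Maya) (r : ℝ) :
    annihilate n (single S r) = if n ∈ S.carrier then single (S.clear n) (r * S.sign n) else 0 := by
  rw [annihilate, linearCombination_single]; split_ifs <;> simp

/-- Creation and annihilation operators are transposes of each other. -/
lemma create_apply_eq_annihilate_apply (n : ℤ) (S T : Maya) :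
    create n (single T 1) S = annihilate n (single S 1) T := by
  classical
  rw [create_single, annihilate_single]
  by_cases hT : n ∈ T.carrier
  · rw [if_pos hT]
    split_ifs with hS
    · rw [single_apply, if_neg]
      · rfl
      · rintro rfl; simp at hT
    · rfl
  · rw [if_neg hT]
    split_ifs with hS
    · rw [single_apply, single_apply]
      by_cases h : T.fill n = S
      · subst h
        rw [if_pos rfl, if_pos (Maya.clear_fill_self hT), Maya.sign_fill_of_le le_rfl]
      · rw [if_neg h, if_neg]
        rintro rfl
        exact h (Maya.fill_clear_self hS)
    · rw [single_apply, if_neg]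
      · rfl
      · rintro rfl; simp at hS

/-- `create` as an element of the endomorphism ring. -/
abbrev createEnd (n : ℤ) : Module.End ℝ Fock := create n

/-- `annihilate` as an element of the endomorphism ring. -/
abbrev annihilateEnd (n : ℤ) : Module.End ℝ Fock := annihilate n

lemma annihilate_anticomm (m n : ℤ) :
    annihilateEnd m * annihilateEnd n = -(annihilateEnd n * annihilateEnd m) := by
  wlog h : m ≤ n generalizing m n
  · exact (neg_eq_iff_eq_neg.mpr (this n m (le_of_not_ge h))).symm
  refine lhom_ext' fun S => LinearMap.ext_ring ?_
  simp only [LinearMap.comp_apply, lsingle_apply, Module.End.mul_apply, LinearMap.neg_apply,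
    annihilate_single]
  rcases h.eq_or_lt with rfl | h
  · split_ifs <;> simp [-single_mul, annihilate_single]
  · by_cases hm : m ∈ S.carrier <;> by_cases hn : n ∈ S.carrier <;>
      simp [-single_mul, hm, hn, annihilate_single, h.ne, h.ne', Maya.sign_clear_of_lt, h,
        Maya.sign_clear_of_le h.le, Maya.clear_comm S m n, mul_comm]

lemma create_anticomm (m n : ℤ) :
    createEnd m * createEnd n = -(createEnd n * createEnd m) := by
  wlog h : m ≤ n generalizing m n
  · exact (neg_eq_iff_eq_neg.mpr (this n m (le_of_not_ge h))).symm
  refine lhom_ext' fun S => LinearMap.ext_ring ?_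
  simp only [LinearMap.comp_apply, lsingle_apply, Module.End.mul_apply, LinearMap.neg_apply,
    create_single]
  rcases h.eq_or_lt with rfl | h
  · split_ifs <;> simp [-single_mul, create_single]
  · by_cases hm : m ∈ S.carrier <;> by_cases hn : n ∈ S.carrier <;>
      simp [-single_mul, hm, hn, create_single, h.ne, h.ne', Maya.sign_fill_of_lt, h,
        Maya.sign_fill_of_le h.le, Maya.fill_comm S m n, mul_comm]

lemma annihilate_mul_create (m n : ℤ) :
    annihilateEnd m * createEnd n = (if m = n then 1 else 0) - createEnd n * annihilateEnd m := by
  refine lhom_ext' fun S => LinearMap.ext_ring ?_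
  simp only [LinearMap.comp_apply, lsingle_apply, Module.End.mul_apply, LinearMap.sub_apply,
    create_single, annihilate_single]
  rcases eq_or_ne m n with rfl | hmn
  · by_cases hm : m ∈ S.carrier
    · simp [-single_mul, hm, create_single, Maya.sign_clear_of_le, Maya.sign_mul_self,
        Maya.fill_clear_self]
    · simp [-single_mul, hm, annihilate_single, Maya.sign_fill_of_le, Maya.sign_mul_self,
        Maya.clear_fill_self]
  · rw [if_neg hmn, LinearMap.zero_apply, zero_sub]
    by_cases hm : m ∈ S.carrier <;> by_cases hn : n ∈ S.carrier
    · simp [-single_mul, hm, hn, create_single, hmn.symm]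
    · rcases lt_or_gt_of_ne hmn with h | h
      · simp [-single_mul, hm, hn, create_single, annihilate_single, hmn.symm,
          Maya.fill_clear_comm S hmn.symm,
          Maya.sign_fill_of_lt, h, Maya.sign_clear_of_le h.le, mul_comm]
      · simp [-single_mul, hm, hn, create_single, annihilate_single, hmn.symm,
          Maya.fill_clear_comm S hmn.symm,
          Maya.sign_clear_of_lt, h, Maya.sign_fill_of_le h.le, mul_comm]
    · simp [-single_mul, hm, hn]
    · simp [-single_mul, hm, hn, annihilate_single, hmn]

/-! ### Fermion bilinears -/

/-- The operator `c†_i c_j` moving a particle from site `j` to site `i`. -/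
def hop (i j : ℤ) : Module.End ℝ Fock := createEnd i * annihilateEnd j

lemma hop_comm (i j k l : ℤ) :
    hop i j * hop k l - hop k l * hop i j =
      (if j = k then hop i l else 0) - (if l = i then hop k j else 0) := by
  have h1 := annihilate_mul_create j k
  have h2 := annihilate_mul_create l i
  have h3 := create_anticomm i k
  have h4 := annihilate_anticomm j l
  have e1 : hop i j * hop k l = createEnd i * (annihilateEnd j * createEnd k) * annihilateEnd l := by
    simp only [hop, mul_assoc]
  have e2 : hop k l * hop i j = createEnd k * (annihilateEnd l * createEnd i) * annihilateEnd j := by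
    simp only [hop, mul_assoc]
  have e3 : createEnd i * (createEnd k * annihilateEnd j) * annihilateEnd l =
      createEnd k * (createEnd i * annihilateEnd l) * annihilateEnd j := by
    have : createEnd i * (createEnd k * annihilateEnd j) * annihilateEnd l =
      (createEnd i * createEnd k) * (annihilateEnd j * annihilateEnd l) := by simp only [mul_assoc]
    rw [this, h3, h4]; rw [neg_mul_neg]; simp only [mul_assoc]
  rw [e1, e2, h1, h2, mul_sub, sub_mul, e3, mul_sub, sub_mul, sub_sub_sub_cancel_right]
  congr 1 <;> split_ifs <;> simp [-single_mul, hop]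

lemma hop_single_of_notMem {i j : ℤ} {S : Maya} (h : j ∉ S.carrier) (r : ℝ) :
    hop i j (single S r) = 0 := by
  simp [-single_mul, hop, annihilate_single, h]

lemma hop_single_of_mem {i j : ℤ} {S : Maya} (hij : i ≠ j) (h : i ∈ S.carrier) (r : ℝ) :
    hop i j (single S r) = 0 := by
  by_cases hj : j ∈ S.carrier
  · simp [-single_mul, hop, annihilate_single, create_single, h, hij, hj]
  · exact hop_single_of_notMem hj r

open Classical in
lemma hop_self_single (i : ℤ) (S : Maya) (r : ℝ) :
    hop i i (single S r) = if i ∈ S.carrier then single S r else 0 := by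
  by_cases h : i ∈ S.carrier
  · simp [-single_mul, hop, annihilate_single, create_single, h, Maya.fill_clear_self,
      Maya.sign_clear_of_le, mul_assoc, Maya.sign_mul_self]
  · simp [-single_mul, hop, annihilate_single, h]

lemma hop_single {i j : ℤ} {S : Maya} (hi : i ∉ S.carrier) (hj : j ∈ S.carrier) :
    hop i j (single S 1) =
      single ((S.clear j).fill i) (S.sign j * (S.clear j).sign i) := by
  simp [-single_mul, hop, annihilate_single, create_single, hi, hj]

lemma vev_hop (i j : ℤ) : vev (hop i j) = if i = j ∧ j ≤ 0 then 1 else 0 := by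
  classical
  rw [vev]
  rcases eq_or_ne i j with rfl | h
  · rw [hop_self_single]
    by_cases h : i ≤ 0 <;> simp [-single_mul, h]
  · by_cases hj : j ≤ 0
    · by_cases hi : i ≤ 0
      · rw [hop_single_of_mem h (by simpa using hi)]; simp [-single_mul, h]
      · rw [hop_single (by simpa using hi) (by simpa using hj), single_apply, if_neg]
        · simp [-single_mul, h]
        · intro h'
          have : i ∈ (Maya.vac 0).carrier := by rw [← h']; simp
          exact hi this
    · rw [hop_single_of_notMem (by simpa using hj)]; simp [-single_mul, hj]

lemma normalOrd_eq (m n : ℤ) :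
    normalOrd (m - n) n = hop (n - m) n - (if m = 0 ∧ n ≤ 0 then (1 : ℝ) else 0) • 1 := by
  have h : psi (m - n) ∘ₗ psiStar n = hop (n - m) n := by
    rw [psi, neg_sub]; rfl
  rw [normalOrd, h, vev_hop]
  have : (n - m = n ∧ n ≤ 0) ↔ (m = 0 ∧ n ≤ 0) := by constructor <;> rintro ⟨h, h'⟩ <;> omega
  simp only [this]
  rfl

/-- Far below the Fermi level all sites are occupied, far above all are empty. -/
lemma Maya.exists_bound (S : Maya) : ∃ N : ℤ, ∀ n, (n < -N → n ∈ S.carrier) ∧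
    (N < n → n ∉ S.carrier) := by
  obtain ⟨a, ha⟩ := S.finite_particles.bddAbove
  obtain ⟨b, hb⟩ := S.finite_holes.bddBelow
  refine ⟨max 0 (max a (-b)), fun n => ⟨fun h => ?_, fun h h' => ?_⟩⟩
  · by_contra h'
    have := hb ⟨show n ≤ 0 by grind, h'⟩
    grind
  · have := ha ⟨h', show ¬ n ≤ 0 by grind⟩
    grind

lemma finite_normalOrd_single (m : ℤ) (S : Maya) (r : ℝ) :
    {n : ℤ | normalOrd (m - n) n (single S r) ≠ 0}.Finite := by
  classical
  obtain ⟨N, hN⟩ := S.exists_bound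
  refine (Set.finite_Icc (-(|N| + |m|)) (|N| + |m|)).subset fun n hne => ?_
  by_contra h
  apply hne
  have h1 := neg_abs_le N
  have h2 := neg_abs_le m
  have h3 := le_abs_self N
  have h4 := le_abs_self m
  rw [normalOrd_eq, LinearMap.sub_apply]
  simp only [Set.mem_Icc, not_and_or, not_le] at h
  rcases h with h | h
  · have hn : n ∈ S.carrier := (hN n).1 (by grind)
    have hn' : n - m ∈ S.carrier := (hN _).1 (by grind)
    obtain hm | hm := eq_or_ne m 0
    · have h0 : n ≤ 0 := by grind
      subst hm; rw [sub_zero, hop_self_single, if_pos hn]; simp [-single_mul, h0]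
    · rw [hop_single_of_mem (by omega) hn']; simp [-single_mul, hm]
  · have hn : n ∉ S.carrier := (hN n).2 (by grind)
    rw [hop_single_of_notMem hn]
    have : ¬ n ≤ 0 := by grind
    simp [-single_mul, this]

lemma finite_normalOrd (m : ℤ) (v : Fock) : {n : ℤ | normalOrd (m - n) n v ≠ 0}.Finite := by
  induction v using Finsupp.induction_linear with
  | zero => simp
  | add v w hv hw =>
    refine (hv.union hw).subset fun n hn => ?_
    by_contra h
    simp only [Set.mem_union, Set.mem_ofPred_eq, not_or, not_not] at h
    exact hn (by rw [map_add, h.1, h.2, add_zero])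
  | single S r => exact finite_normalOrd_single m S r

lemma finite_smul_normalOrd (c : ℤ → ℝ) (m : ℤ) (v : Fock) :
    (Function.support fun n : ℤ => c n • normalOrd (m - n) n v).Finite :=
  (finite_normalOrd m v).subset fun n hn h => hn (by simp [-single_mul, h])

/-- The defining formula of a fermion bilinear holds on every vector, not only on the basis. -/
lemma bilinear_apply (c : ℤ → ℝ) (m : ℤ) (v : Fock) :
    bilinear c m v = ∑ᶠ n : ℤ, c n • normalOrd (m - n) n v := by
  induction v using Finsupp.induction_linear with
  | zero => simp
  | add v w hv hw =>
    rw [map_add, hv, hw, ← finsum_add_distrib (finite_smul_normalOrd c m v)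
      (finite_smul_normalOrd c m w)]
    simp
  | single S r =>
    rw [bilinear, linearCombination_single, smul_finsum]
    refine finsum_congr fun n => ?_
    rw [smul_comm, ← map_smul, smul_single, smul_eq_mul, mul_one]

lemma bilinear_apply_sum (c : ℤ → ℝ) (m : ℤ) (v : Fock) (I : Finset ℤ)
    (hI : ∀ n, normalOrd (m - n) n v ≠ 0 → n ∈ I) :
    bilinear c m v = ∑ n ∈ I, c n • normalOrd (m - n) n v := by
  rw [bilinear_apply]
  refine finsum_eq_sum_of_support_subset _ fun n hn => hI n fun h => hn ?_
  simp [-single_mul, h]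

/-- `[J_l, c†_a c_b] = c†_{a-l} c_b - c†_a c_{b+l}` for `l ≠ 0`. -/
lemma current_hop_comm {l : ℤ} (hl : l ≠ 0) (a b : ℤ) (v : Fock) :
    bilinear (fun _ => 1) l (hop a b v) - hop a b (bilinear (fun _ => 1) l v) =
      hop (a - l) b v - hop a (b + l) v := by
  set I : Finset ℤ := (finite_normalOrd l v).toFinset ∪ (finite_normalOrd l (hop a b v)).toFinset ∪
    {a, b + l} with hI
  rw [bilinear_apply_sum _ _ _ I (by simp [-single_mul, hI]; tauto),
    bilinear_apply_sum _ _ _ I (by simp [-single_mul, hI]; tauto), map_sum, ← Finset.sum_sub_distrib]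
  have h1 : ∀ n ∈ I, (1 : ℝ) • normalOrd (l - n) n (hop a b v) -
      hop a b ((1 : ℝ) • normalOrd (l - n) n v) =
      (if n = a then hop (a - l) b v else 0) - (if n = b + l then hop a (b + l) v else 0) := by
    intro n _
    have := LinearMap.congr_fun (hop_comm (n - l) n a b) v
    simp only [LinearMap.sub_apply, Module.End.mul_apply] at this
    simp only [normalOrd_eq, hl, false_and, if_false, zero_smul, sub_zero, one_smul]
    rw [this]
    congr 1
    · split_ifs with h
      · rw [h]
      · rfl
    · have : (b = n - l) ↔ (n = b + l) := by omega
      simp only [this]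
      split_ifs with h
      · rw [h]
      · rfl
  rw [Finset.sum_congr rfl h1, Finset.sum_sub_distrib, Finset.sum_ite_eq', Finset.sum_ite_eq',
    if_pos (by simp [-single_mul, hI]), if_pos (by simp [-single_mul, hI])]

/-- The commutator of a current with a fermion bilinear. The last term is the central extension: it
comes from the normal ordering constants, which only the diagonal terms (`m + l = 0`) have, and it
counts the sites that the shift by `l` carries across the Fermi level. -/
lemma current_bilinear_comm {l : ℤ} (hl : 0 < l) (c : ℤ → ℝ) (m : ℤ) (v : Fock) :
    bilinear (fun _ => 1) l (bilinear c m v) - bilinear c m (bilinear (fun _ => 1) l v) =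
      bilinear (fun n => c n - c (n - l)) (m + l) v +
        (if m + l = 0 then ∑ n ∈ Finset.Ioc (-l) 0, c n else 0) • v := by
  set w := bilinear (fun _ => 1) l v with hw
  set I₀ : Finset ℤ := (finite_normalOrd m v).toFinset ∪ (finite_normalOrd m w).toFinset ∪
    (finite_normalOrd (m + l) v).toFinset ∪ Finset.Ioc (-l) 0
  set I : Finset ℤ := I₀ ∪ I₀.image (fun n => n - l) with hI
  have hI1 : ∀ n ∈ I₀, n ∈ I := fun n hn => Finset.mem_union_left _ hn
  have hI2 : ∀ n ∈ I₀, n - l ∈ I := fun n hn =>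
    Finset.mem_union_right _ (Finset.mem_image_of_mem _ hn)
  rw [bilinear_apply_sum c m v I fun n hn => hI1 _ (by simp [I₀, hn]),
    bilinear_apply_sum c m w I fun n hn => hI1 _ (by simp [I₀, hn]), map_sum,
    ← Finset.sum_sub_distrib]
  have h1 : ∀ n ∈ I, bilinear (fun _ => 1) l (c n • normalOrd (m - n) n v) -
      c n • normalOrd (m - n) n w =
      (c n • normalOrd (m + l - n) n v - c n • normalOrd (m + l - (n + l)) (n + l) v) +
      (c n * (if m + l = 0 ∧ n ≤ 0 then 1 else 0) -
        c n * (if m + l = 0 ∧ n + l ≤ 0 then 1 else 0)) • v := by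
    intro n _
    have h := current_hop_comm hl.ne' (n - m) n v
    have e1 : n - m - l = n - (m + l) := by ring
    have e2 : n - m = (n + l) - (m + l) := by ring
    rw [normalOrd_eq m, normalOrd_eq (m + l), normalOrd_eq (m + l)]
    simp only [LinearMap.sub_apply, LinearMap.smul_apply, Module.End.one_apply, map_smul, map_sub]
    rw [← e1, ← e2, ← smul_sub, sub_sub_sub_comm, hw, h]
    module
  rw [Finset.sum_congr rfl h1, Finset.sum_add_distrib, Finset.sum_sub_distrib, ← Finset.sum_smul]
  congr 1
  · have h2 : ∑ n ∈ I, c n • normalOrd (m + l - (n + l)) (n + l) v =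
        ∑ n ∈ I.image (fun n => n + l), c (n - l) • normalOrd (m + l - n) n v := by
      rw [Finset.sum_image fun a _ b _ h => by simpa using h]
      simp
    have h3 : ∀ n, normalOrd (m + l - n) n v ≠ 0 → n ∈ I.image (fun n => n + l) := by
      intro n hn
      exact Finset.mem_image.2 ⟨n - l, hI2 n (by simp [I₀, hn]), by ring⟩
    have h4 : ∀ n, normalOrd (m + l - n) n v ≠ 0 → n ∈ I := by
      intro n hn
      exact hI1 n (by simp [I₀, hn])
    rw [h2, ← bilinear_apply_sum c (m + l) v I h4,
      ← bilinear_apply_sum (fun n => c (n - l)) (m + l) v _ h3,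
      bilinear_apply_sum c (m + l) v I h4,
      bilinear_apply_sum (fun n => c (n - l)) (m + l) v I h4,
      bilinear_apply_sum (fun n => c n - c (n - l)) (m + l) v I h4, ← Finset.sum_sub_distrib]
    exact Finset.sum_congr rfl fun n _ => (sub_smul _ _ _).symm
  · congr 1
    split_ifs with h
    · rw [← Finset.sum_subset (s₁ := Finset.Ioc (-l) 0) (s₂ := I)]
      · refine Finset.sum_congr rfl fun n hn => ?_
        rw [Finset.mem_Ioc] at hn
        rw [if_pos ⟨h, hn.2⟩, if_neg (by omega)]; ring
      · exact fun n hn => hI1 n (by simp only [I₀, Finset.mem_union]; exact Or.inr hn)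
      · intro n _ hn
        rw [Finset.mem_Ioc, not_and_or] at hn
        by_cases h0 : n ≤ 0
        · rw [if_pos ⟨h, h0⟩, if_pos (by omega)]; ring
        · rw [if_neg (by omega), if_neg (by omega)]; ring
    · simp [h]

/-! ### Matrix elements, weights and energy -/

/-- A hop matrix element is symmetric under exchange of the two sites. -/
lemma hop_transpose (i j : ℤ) (S T : Maya) :
    hop i j (single T 1) S = hop j i (single S 1) T := by
  classical
  have key : ∀ i j : ℤ, ∀ S T : Maya, hop i j (single T 1) S =
      ∑ᶠ U, annihilate i (single S 1) U * annihilate j (single T 1) U := by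
    intro i j S T
    have : hop i j (single T 1) = create i (annihilate j (single T 1)) := rfl
    rw [this]
    have h : ∀ v : Fock, create i v S = ∑ᶠ U, annihilate i (single S 1) U * v U := by
      intro v
      induction v using Finsupp.induction_linear with
      | zero => simp
      | add v w hv hw =>
        rw [map_add, Finsupp.add_apply, hv, hw, ← finsum_add_distrib]
        · simp [mul_add]
        · exact v.hasFiniteSupport.subset fun U hU h => hU (by simp_all)
        · exact w.hasFiniteSupport.subset fun U hU h => hU (by simp_all)
      | single U r =>
        rw [finsum_eq_single _ U fun V hV => by simp [hV.symm], single_eq_same,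
          ← create_apply_eq_annihilate_apply, ← mul_one r, ← smul_eq_mul r, ← smul_single,
          map_smul]
        simp [mul_comm]
    exact h _
  rw [key, key]
  exact finsum_congr fun U => mul_comm _ _

lemma normalOrd_transpose (m n : ℤ) (S T : Maya) :
    normalOrd (m - n) n (single T 1) S = normalOrd (-m - (n - m)) (n - m) (single S 1) T := by
  classical
  rw [normalOrd_eq, normalOrd_eq, LinearMap.sub_apply, LinearMap.sub_apply, Finsupp.sub_apply,
    Finsupp.sub_apply, hop_transpose]
  congr 1
  · congr 3; ring
  · simp only [LinearMap.smul_apply, Module.End.one_apply, Finsupp.smul_apply, single_apply,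
      eq_comm (a := T)]
    rcases eq_or_ne m 0 with rfl | h <;> simp_all

/-- A single matrix element is a finite sum of the matrix elements of the hops. -/
lemma bilinear_single_apply (c : ℤ → ℝ) (m : ℤ) (S T : Maya) :
    bilinear c m (single T 1) S = ∑ᶠ n, c n * normalOrd (m - n) n (single T 1) S := by
  rw [bilinear_apply_sum c m _ (finite_normalOrd m (single T 1)).toFinset (by simp),
    Finsupp.finsetSum_apply,
    finsum_eq_sum_of_support_subset (s := (finite_normalOrd m (single T 1)).toFinset)]
  · rfl
  · intro n hn
    simp only [Set.Finite.coe_toFinset, Set.mem_ofPred_eq]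
    rintro h
    exact hn (by simp [h])

lemma bilinear_transpose (c : ℤ → ℝ) (m : ℤ) (S T : Maya) :
    bilinear c m (single T 1) S = bilinear (fun n => c (n + m)) (-m) (single S 1) T := by
  rw [bilinear_single_apply, bilinear_single_apply, ← finsum_comp_equiv (Equiv.subRight m)
    (f := fun n => c (n + m) * normalOrd (-m - n) n (single S 1) T)]
  refine finsum_congr fun n => ?_
  rw [normalOrd_transpose, Equiv.subRight_apply, sub_add_cancel]

namespace Maya

open Classical in
/-- The weight `∑_n φ(n)` of a Maya diagram, counted relative to the charge `0` vacuum: particles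
count positively, holes negatively. -/
def wt (φ : ℤ → ℝ) (S : Maya) : ℝ :=
  ∑ᶠ n, φ n * ((if n ∈ S.carrier then 1 else 0) - (if n ≤ 0 then 1 else 0))

open Classical in
lemma wt_support_finite (φ : ℤ → ℝ) (S : Maya) : (Function.support fun n =>
    φ n * ((if n ∈ S.carrier then (1 : ℝ) else 0) - (if n ≤ 0 then 1 else 0))).Finite := by
  refine (S.finite_particles.union S.finite_holes).subset fun n hn => ?_
  by_contra h
  apply hn
  simp only [Set.mem_union, Set.mem_sdiff, Set.mem_Iic] at h
  by_cases h1 : n ∈ S.carrier <;> by_cases h2 : n ≤ 0 <;> simp_all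

lemma wt_fill (φ : ℤ → ℝ) {S : Maya} {n : ℤ} (hn : n ∉ S.carrier) :
    (S.fill n).wt φ = S.wt φ + φ n := by
  classical
  have : φ n = ∑ᶠ k, if k = n then φ n else 0 := by
    rw [finsum_eq_single _ n (by simp +contextual)]; simp
  rw [this, wt, wt, ← finsum_add_distrib (wt_support_finite φ S)
    ((Set.finite_singleton n).subset fun k hk => by
      by_contra h
      exact hk (if_neg (by simpa using h)))]
  refine finsum_congr fun k => ?_
  rcases eq_or_ne k n with rfl | h
  · simp [hn, mul_sub]; ring
  · simp [h]

lemma wt_clear (φ : ℤ → ℝ) {S : Maya} {n : ℤ} (hn : n ∈ S.carrier) :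
    (S.clear n).wt φ = S.wt φ - φ n := by
  have := wt_fill φ (S := S.clear n) (n := n) (by simp)
  rw [fill_clear_self hn] at this
  linarith

end Maya

/-- A hop changes all weights by the difference between the two sites. -/
lemma wt_of_hop_ne_zero {i j : ℤ} {S T : Maya} (φ : ℤ → ℝ) (h : hop i j (single T 1) S ≠ 0) :
    S.wt φ = T.wt φ + φ i - φ j := by
  classical
  rcases eq_or_ne i j with rfl | hij
  · rw [hop_self_single] at h
    split_ifs at h with h'
    · rw [single_apply] at h
      have : T = S := by by_contra h''; simp [h''] at h
      rw [this]; ring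
    · simp at h
  · by_cases hj : j ∈ T.carrier
    · by_cases hi : i ∈ T.carrier
      · rw [hop_single_of_mem hij hi] at h; simp at h
      · rw [hop_single hi hj, single_apply] at h
        have : (T.clear j).fill i = S := by by_contra h''; simp [h''] at h
        rw [← this, Maya.wt_fill φ (by simp [hi]), Maya.wt_clear φ hj]; ring
    · rw [hop_single_of_notMem hj] at h; simp at h

/-- The bilinears of degree zero are diagonal, with the weights as eigenvalues. -/
lemma bilinear_zero_single (φ : ℤ → ℝ) (S : Maya) (r : ℝ) :
    bilinear φ 0 (single S r) = S.wt φ • single S r := by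
  classical
  have h : ∀ n, normalOrd (0 - n) n (single S r) =
      ((if n ∈ S.carrier then (1 : ℝ) else 0) - (if n ≤ 0 then 1 else 0)) • single S r := by
    intro n
    rw [normalOrd_eq, sub_zero, LinearMap.sub_apply, hop_self_single, sub_smul]
    by_cases h : n ≤ 0 <;> simp [-single_mul, h]
  rw [bilinear_apply, Maya.wt, finsum_smul' (Maya.wt_support_finite φ S)]
  exact finsum_congr fun n => by rw [h, smul_smul]

namespace Maya

open Classical in
/-- The energy of a Maya diagram: the eigenvalue of `L_0`, which is a natural number. -/
def energy (S : Maya) : ℕ := ∑ᶠ n : ℤ, if n ∈ S.carrier ↔ n ≤ 0 then 0 else n.natAbs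

open Classical in
lemma energy_support_finite (S : Maya) :
    (Function.support fun n : ℤ => if n ∈ S.carrier ↔ n ≤ 0 then 0 else n.natAbs).Finite := by
  refine (S.finite_particles.union S.finite_holes).subset fun n hn => ?_
  by_contra h
  refine hn (if_pos ?_)
  simp only [Set.mem_union, Set.mem_sdiff, Set.mem_Iic] at h
  tauto

lemma wt_id (S : Maya) : S.wt (fun n => (n : ℝ)) = S.energy := by
  classical
  rw [wt, energy, ← Nat.coe_castAddMonoidHom, AddMonoidHom.map_finsum _ S.energy_support_finite]
  refine finsum_congr fun n => ?_
  have hn : ((n.natAbs : ℕ) : ℝ) = |(n : ℝ)| := by rw [Nat.cast_natAbs, Int.cast_abs]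
  by_cases h1 : n ∈ S.carrier <;> by_cases h2 : n ≤ 0 <;> simp [h1, h2, hn]
  · have : (n : ℝ) > 0 := by exact_mod_cast not_le.1 h2
    rw [abs_of_pos this]
  · have : (n : ℝ) ≤ 0 := by exact_mod_cast h2
    rw [abs_of_nonpos this]

/-- In a state of energy at most `d` the sites `n` with `|n| > d` are as in the vacuum. -/
lemma mem_iff_of_energy_lt {S : Maya} {n : ℤ} (h : S.energy < n.natAbs) :
    n ∈ S.carrier ↔ n ≤ 0 := by
  classical
  by_contra h'
  have := single_le_finsum n S.energy_support_finite (fun _ => Nat.zero_le _)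
  rw [if_neg h'] at this
  exact absurd this (not_le.2 h)

lemma finite_energy_le (d : ℕ) : {S : Maya | S.energy ≤ d}.Finite := by
  refine Set.Finite.of_finite_image (f := fun S : Maya => S.carrier ∩ Set.Icc (-(d : ℤ)) d) ?_ ?_
  · refine (Set.finite_Icc (-(d : ℤ)) d).finite_subsets.subset ?_
    rintro _ ⟨S, -, rfl⟩
    exact Set.inter_subset_right
  · intro S hS T hT h
    ext n
    by_cases hn : n ∈ Set.Icc (-(d : ℤ)) d
    · have := Set.ext_iff.1 h n
      simpa [Set.mem_inter_iff, hn] using this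
    · have hd : d < n.natAbs := by rw [Set.mem_Icc] at hn; omega
      rw [mem_iff_of_energy_lt (lt_of_le_of_lt hS hd), mem_iff_of_energy_lt (lt_of_le_of_lt hT hd)]

/-- The finite set of Maya diagrams of energy at most `d`. -/
def level (d : ℕ) : Finset Maya := (finite_energy_le d).toFinset

@[simp] lemma mem_level {d : ℕ} {S : Maya} : S ∈ level d ↔ S.energy ≤ d := by simp [level]

end Maya

/-- A nonzero matrix element of a bilinear of degree `m` comes from moving one particle from some
site `n` to the site `n - m`. -/
lemma exists_hop_of_bilinear_ne_zero {c : ℤ → ℝ} {m : ℤ} {S T : Maya}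
    (h : bilinear c m (single T 1) S ≠ 0) :
    S = T ∧ m = 0 ∨ ∃ n, hop (n - m) n (single T 1) S ≠ 0 := by
  classical
  rw [bilinear_single_apply] at h
  obtain ⟨n, hn⟩ : ∃ n, c n * normalOrd (m - n) n (single T 1) S ≠ 0 := by
    by_contra! h'
    exact h (by simp [h'])
  have hn := right_ne_zero_of_mul hn
  by_cases h0 : hop (n - m) n (single T 1) S = 0
  · rw [normalOrd_eq, LinearMap.sub_apply, Finsupp.sub_apply, h0, zero_sub, neg_ne_zero] at hn
    simp only [LinearMap.smul_apply, Module.End.one_apply, Finsupp.smul_apply, single_apply] at hn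
    left
    split_ifs at hn <;> simp_all
  · exact Or.inr ⟨n, h0⟩

/-- A bilinear of degree `m` lowers the energy by `m`. -/
lemma energy_of_bilinear_ne_zero {c : ℤ → ℝ} {m : ℤ} {S T : Maya}
    (h : bilinear c m (single T 1) S ≠ 0) : (T.energy : ℤ) = S.energy + m := by
  obtain ⟨rfl, rfl⟩ | ⟨n, hn⟩ := exists_hop_of_bilinear_ne_zero h
  · simp
  · have := wt_of_hop_ne_zero (fun n => (n : ℝ)) hn
    rw [Maya.wt_id, Maya.wt_id] at this
    have h' : (S.energy : ℝ) = ((T.energy - m : ℤ) : ℝ) := by rw [this]; push_cast; ring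
    have : (S.energy : ℤ) = T.energy - m := by exact_mod_cast h'
    omega

/-! ### Locally nilpotent exponentials -/

section LocallyNilpotent

variable {R M : Type*} [CommRing R] [Algebra ℝ R] [AddCommGroup M] [Module R M] [Module ℝ M]
  [IsScalarTower ℝ R M]

/-- Every vector is annihilated by all sufficiently high powers of `A`. -/
def LocallyNilpotent (A : Module.End R M) : Prop := ∀ v, ∃ N, ∀ n, N ≤ n → (A ^ n) v = 0

lemma LocallyNilpotent.finite_support {R M : Type*} [CommRing R] [AddCommGroup M] [Module R M]
    [Module ℝ M] {A : Module.End R M} (hA : LocallyNilpotent A) (v : M) :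
    (Function.support fun n : ℕ => ((n.factorial : ℝ)⁻¹) • (A ^ n) v).Finite := by
  obtain ⟨N, hN⟩ := hA v
  refine (Set.finite_Iio N).subset fun n hn => ?_
  by_contra h
  exact hn (by simp [hN n (by simpa using h)])

/-- The exponential `∑_n A^n / n!` of a locally nilpotent endomorphism, a finite sum on each
vector. -/
def locExp (A : Module.End R M) (hA : LocallyNilpotent A) : Module.End R M where
  toFun v := ∑ᶠ n : ℕ, ((n.factorial : ℝ)⁻¹) • (A ^ n) v
  map_add' v w := by
    rw [← finsum_add_distrib (hA.finite_support v) (hA.finite_support w)]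
    simp
  map_smul' r v := by
    rw [RingHom.id_apply, smul_finsum' r (hA.finite_support v)]
    refine finsum_congr fun n => ?_
    rw [map_smul, algebra_compatible_smul R (_ : ℝ) (r • (A ^ n) v),
      algebra_compatible_smul R (_ : ℝ) ((A ^ n) v), smul_comm]

lemma locExp_apply {A : Module.End R M} (hA : LocallyNilpotent A) (v : M) {N : ℕ}
    (hN : ∀ n, N ≤ n → (A ^ n) v = 0) :
    locExp A hA v = ∑ n ∈ Finset.range N, ((n.factorial : ℝ)⁻¹) • (A ^ n) v := by
  refine finsum_eq_sum_of_support_subset _ fun n hn => ?_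
  rw [Finset.coe_range, Set.mem_Iio]
  by_contra h
  exact hn (by simp [hN n (by simpa using h)])

/-- If `D A = A D + B` and `B` commutes with `A`, then `D` behaves like a derivation on
`exp A`: `D exp A = exp A D + exp A B`. -/
lemma comm_locExp {A B : Module.End R M} (hA : LocallyNilpotent A) (D : M →ₗ[ℝ] M)
    (hD : ∀ v, D (A v) = A (D v) + B v) (hAB : A * B = B * A) (v : M) :
    D (locExp A hA v) = locExp A hA (D v) + locExp A hA (B v) := by
  have hpow : ∀ (n : ℕ) (v : M),
      D ((A ^ (n + 1)) v) = (A ^ (n + 1)) (D v) + ((n : ℝ) + 1) • (A ^ n) (B v) := by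
    intro n
    induction n with
    | zero => intro v; simp [hD]
    | succ n ih =>
      intro v
      have hB : (A ^ (n + 1)) (B v) = A ((A ^ n) (B v)) := by rw [pow_succ']; rfl
      have hB' : B ((A ^ (n + 1)) v) = (A ^ (n + 1)) (B v) := by
        have : Commute B (A ^ (n + 1)) := (Commute.pow_right (show B * A = A * B from hAB.symm) _)
        exact LinearMap.congr_fun this v
      have e : ∀ w, (A ^ (n + 1 + 1)) w = A ((A ^ (n + 1)) w) := fun w => by
        rw [pow_succ' A (n + 1)]; rfl
      rw [e, hD, ih, map_add, e, hB', add_assoc, hB]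
      congr 1
      rw [algebra_compatible_smul R, map_smul, ← algebra_compatible_smul R]
      push_cast
      module
  obtain ⟨N₁, h₁⟩ := hA v
  obtain ⟨N₂, h₂⟩ := hA (D v)
  obtain ⟨N₃, h₃⟩ := hA (B v)
  set N := N₁ + N₂ + N₃
  rw [locExp_apply hA v (N := N + 1) fun n hn => h₁ n (by omega),
    locExp_apply hA (D v) (N := N + 1) fun n hn => h₂ n (by omega),
    locExp_apply hA (B v) (N := N) fun n hn => h₃ n (by omega), map_sum,
    Finset.sum_range_succ', Finset.sum_range_succ' (fun n => (n.factorial : ℝ)⁻¹ • (A ^ n) (D v)),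
    add_right_comm, ← Finset.sum_add_distrib]
  congr 1
  · refine Finset.sum_congr rfl fun n _ => ?_
    rw [map_smul, hpow, smul_add, smul_smul, Nat.factorial_succ]
    congr 2
    push_cast
    have : (n.factorial : ℝ) ≠ 0 := by positivity
    have : (n : ℝ) + 1 ≠ 0 := by positivity
    field_simp
  · simp

end LocallyNilpotent

section Entries

variable {R : Type*} [CommRing R]

/-- The matrix of an endomorphism of the Fock space with coefficients in `R`. -/
def entries (A : Module.End R (Maya →₀ R)) : Matrix Maya Maya R := fun S U => A (single U 1) S

lemma apply_eq_sum (A : Module.End R (Maya →₀ R)) (v : Maya →₀ R) (S : Maya) :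
    A v S = ∑ T ∈ v.support, A (single T 1) S * v T := by
  conv_lhs => rw [← v.sum_single, Finsupp.sum, map_sum, Finsupp.finsetSum_apply]
  refine Finset.sum_congr rfl fun T _ => ?_
  rw [← mul_one (v T), ← smul_eq_mul, ← smul_single, map_smul, Finsupp.smul_apply, smul_eq_mul,
    smul_eq_mul, mul_one, mul_comm]

lemma apply_eq_sum_of_subset (A : Module.End R (Maya →₀ R)) (v : Maya →₀ R) (S : Maya)
    {I : Finset Maya} (hI : v.support ⊆ I) : A v S = ∑ T ∈ I, A (single T 1) S * v T := by
  rw [apply_eq_sum]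
  refine Finset.sum_subset hI fun T _ hT => ?_
  rw [notMem_support_iff.1 hT, mul_zero]

lemma entries_col_finite (A : Module.End R (Maya →₀ R)) (U : Maya) :
    (Function.support fun S => entries A S U).Finite :=
  (A (single U 1)).hasFiniteSupport

lemma locallyNilpotent_entry_support [Algebra ℝ R] {A : Module.End R (Maya →₀ R)}
    (hA : LocallyNilpotent A) (S U : Maya) :
    (Function.support fun n : ℕ => ((n.factorial : ℝ)⁻¹) • entries (A ^ n) S U).Finite :=
  (hA.finite_support (single U 1)).subset fun n hn h => hn (by
    have := DFunLike.congr_fun h S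
    simpa [entries] using this)

variable [TopologicalSpace R]

/-- Matrices of endomorphisms compose by finite sums. -/
lemma composable_of_col_finite {A B : Matrix Maya Maya R}
    (hB : ∀ U, (Function.support fun S => B S U).Finite) : Composable A B := fun _ U =>
  summable_of_hasFiniteSupport ((hB U).subset fun T hT h => hT (by simp [h]))

lemma composable_of_row_finite {A B : Matrix Maya Maya R}
    (hA : ∀ S, (Function.support fun T => A S T).Finite) : Composable A B := fun S _ =>
  summable_of_hasFiniteSupport ((hA S).subset fun T hT h => hT (by simp [h]))

lemma opMul_entries (A B : Module.End R (Maya →₀ R)) :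
    opMul (entries A) (entries B) = entries (A * B) := by
  ext S U
  rw [opMul, tsum_eq_sum (s := (B (single U 1)).support)]
  · exact (apply_eq_sum A (B (single U 1)) S).symm
  · intro T hT
    rw [entries, entries, notMem_support_iff.1 hT, mul_zero]

lemma opMul_transpose (A B : Matrix Maya Maya R) :
    opMul A.transpose B.transpose = (opMul B A).transpose := by
  ext S U
  simp only [opMul, Matrix.transpose_apply, mul_comm]

lemma opPow_entries (A : Module.End R (Maya →₀ R)) (n : ℕ) :
    opPow (entries A) n = entries (A ^ n) := by
  classical
  induction n with
  | zero =>
    ext S U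
    rw [opPow, pow_zero, entries, Module.End.one_apply, single_apply, Matrix.one_apply]
    simp only [eq_comm]
  | succ n ih => rw [opPow, ih, opMul_entries, pow_succ']

lemma opPow_entries_transpose (A : Module.End R (Maya →₀ R)) (n : ℕ) :
    opPow (entries A).transpose n = (entries (A ^ n)).transpose := by
  classical
  induction n with
  | zero =>
    rw [← opPow_entries]
    exact Matrix.transpose_one.symm
  | succ n ih => rw [opPow, ih, opMul_transpose, opMul_entries, pow_succ]

variable [Algebra ℝ R]

lemma locExp_entry_tsum {A : Module.End R (Maya →₀ R)} (hA : LocallyNilpotent A) (S U : Maya) :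
    ∑' n : ℕ, ((n.factorial : ℝ)⁻¹) • entries (A ^ n) S U = entries (locExp A hA) S U := by
  obtain ⟨N, hN⟩ := hA (single U 1)
  rw [entries, locExp_apply hA _ hN, tsum_eq_sum (s := Finset.range N), Finsupp.finsetSum_apply]
  · rfl
  · intro n hn
    rw [Finset.mem_range, not_lt] at hn
    rw [entries, hN n hn]
    simp

lemma opExp_entries {A : Module.End R (Maya →₀ R)} (hA : LocallyNilpotent A) :
    opExp (entries A) = entries (locExp A hA) := by
  ext S U
  simp only [opExp, opPow_entries]
  exact locExp_entry_tsum hA S U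

lemma opExp_entries_transpose {A : Module.End R (Maya →₀ R)} (hA : LocallyNilpotent A) :
    opExp (entries A).transpose = (entries (locExp A hA)).transpose := by
  ext S U
  simp only [opExp, opPow_entries_transpose]
  exact locExp_entry_tsum hA U S

lemma exponentiable_entries {A : Module.End R (Maya →₀ R)} (hA : LocallyNilpotent A) :
    Exponentiable (entries A) := by
  refine ⟨fun n => ?_, fun S U => ?_⟩
  · rw [opPow_entries]
    exact composable_of_col_finite (entries_col_finite _)
  · simp only [opPow_entries]
    exact summable_of_hasFiniteSupport (locallyNilpotent_entry_support hA S U)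

lemma exponentiable_entries_transpose {A : Module.End R (Maya →₀ R)} (hA : LocallyNilpotent A) :
    Exponentiable (entries A).transpose := by
  refine ⟨fun n => ?_, fun S U => ?_⟩
  · exact composable_of_row_finite (entries_col_finite _)
  · simp only [opPow_entries_transpose]
    exact summable_of_hasFiniteSupport (locallyNilpotent_entry_support hA U S)

end Entries

/-! ### Sums of lowering currents -/

section EnergyFiltration

variable {R : Type*} [CommRing R]

/-- The vectors of energy at most `N`. -/
def energyLE (R : Type*) [CommRing R] (N : ℕ) : Submodule R (Maya →₀ R) :=
  supported R R {S : Maya | S.energy ≤ N}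

lemma single_mem_energyLE {T : Maya} {N : ℕ} (h : T.energy ≤ N) (r : R) :
    single T r ∈ energyLE R N := single_mem_supported _ _ h

lemma exists_mem_energyLE (v : Maya →₀ R) : ∃ N, v ∈ energyLE R N := by
  refine ⟨v.support.sup Maya.energy, ?_⟩
  rw [energyLE, mem_supported]
  exact fun T hT => Finset.le_sup (f := Maya.energy) hT

lemma energyLE_mono {M N : ℕ} (h : M ≤ N) : energyLE R M ≤ energyLE R N :=
  supported_mono fun _ hS => le_trans hS h

lemma energyLE_induction {N : ℕ} {p : (Maya →₀ R) → Prop} (h0 : p 0)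
    (hadd : ∀ v w, p v → p w → p (v + w)) (hs : ∀ (T : Maya) (r : R), T.energy ≤ N → p (r • single T 1))
    {v : Maya →₀ R} (hv : v ∈ energyLE R N) : p v := by
  rw [← v.sum_single, Finsupp.sum]
  refine Finset.sum_induction _ p hadd h0 fun T hT => ?_
  have := hs T (v T) ((mem_supported _ _).1 hv hT)
  rwa [smul_single, smul_eq_mul, mul_one] at this

end EnergyFiltration

section Current

variable {R : Type*} [CommRing R] [Algebra ℝ R]

/-- The extension of scalars from `ℝ` to `R` of an operator on the Fock space. -/
def extend (R : Type*) [CommRing R] [Algebra ℝ R] (f : Module.End ℝ Fock) :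
    Module.End R (Maya →₀ R) :=
  linearCombination R fun T => (f (single T 1)).mapRange (algebraMap ℝ R) (map_zero _)

lemma extend_single_one (f : Module.End ℝ Fock) (T : Maya) :
    extend R f (single T 1) = (f (single T 1)).mapRange (algebraMap ℝ R) (map_zero _) := by
  rw [extend, linearCombination_single, one_smul]

lemma entries_extend (f : Module.End ℝ Fock) (S T : Maya) :
    entries (extend R f) S T = algebraMap ℝ R (f (single T 1) S) := by
  rw [entries, extend_single_one, mapRange_apply]

lemma extend_mapRange (f : Module.End ℝ Fock) (v : Fock) :
    extend R f (v.mapRange (algebraMap ℝ R) (map_zero _)) =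
      (f v).mapRange (algebraMap ℝ R) (map_zero _) := by
  ext S
  rw [apply_eq_sum_of_subset _ _ _ (Finsupp.support_mapRange), mapRange_apply, apply_eq_sum f v,
    map_sum]
  refine Finset.sum_congr rfl fun T _ => ?_
  rw [map_mul, mapRange_apply]
  congr 1
  exact entries_extend f S T

lemma extend_mul (f g : Module.End ℝ Fock) : extend R (f * g) = extend R f * extend R g := by
  refine lhom_ext' fun S => LinearMap.ext_ring ?_
  simp only [LinearMap.comp_apply, lsingle_apply, Module.End.mul_apply, extend_single_one,
    extend_mapRange]

lemma extend_real (f : Module.End ℝ Fock) : extend ℝ f = f := by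
  refine lhom_ext' fun S => LinearMap.ext_ring ?_
  simp only [LinearMap.comp_apply, lsingle_apply, extend_single_one]
  ext; simp

/-- The current `J_k` with scalars extended to `R`. -/
def current (R : Type*) [CommRing R] [Algebra ℝ R] (k : ℤ) : Module.End R (Maya →₀ R) :=
  extend R (bilinear (fun _ => 1) k)

lemma current_mem {N k : ℕ} {v : Maya →₀ R} (hv : v ∈ energyLE R N) :
    current R k v ∈ energyLE R (N - k) := by
  refine energyLE_induction (p := fun v => current R k v ∈ energyLE R (N - k)) ?_ ?_ ?_ hv
  · simp
  · intro v w h1 h2; rw [map_add]; exact add_mem h1 h2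
  · intro T r hT
    rw [map_smul]
    refine Submodule.smul_mem _ _ ?_
    rw [energyLE, mem_supported]
    intro S hS
    rw [current, extend_single_one] at hS
    have := energy_of_bilinear_ne_zero (mem_support_iff.1 (support_mapRange hS))
    simp only [Set.mem_ofPred_eq]; omega

lemma current_eq_zero {N k : ℕ} {v : Maya →₀ R} (hv : v ∈ energyLE R N) (hk : N < k) :
    current R k v = 0 := by
  refine energyLE_induction (p := fun v => current R k v = 0) ?_ ?_ ?_ hv
  · simp
  · intro v w h1 h2; rw [map_add, h1, h2, add_zero]
  · intro T r hT
    rw [map_smul, current, extend_single_one]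
    have : bilinear (fun _ => 1) k (single T 1) = 0 := by
      ext S
      by_contra h
      have := energy_of_bilinear_ne_zero h
      omega
    rw [this]; simp

lemma current_comm {k l : ℕ} (hk : 0 < k) (hl : 0 < l) :
    current R k * current R l = current R l * current R k := by
  rw [current, current, ← extend_mul, ← extend_mul]
  refine congrArg (extend R) (LinearMap.ext fun v => ?_)
  have := current_bilinear_comm (l := k) (by exact_mod_cast hk) (fun _ => 1) l v
  rw [if_neg (by omega), zero_smul, add_zero] at this
  have h0 : bilinear (fun n : ℤ => (fun _ : ℤ => (1 : ℝ)) n - (fun _ => 1) (n - k)) (l + k) v = 0 := by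
    rw [bilinear_apply]; simp
  rw [h0] at this
  exact sub_eq_zero.1 this

/-- The lowering operator `∑_{k ≥ 1} c(k) J_k`. -/
def lowering (c : ℕ+ → R) : Module.End R (Maya →₀ R) :=
  linearCombination R fun T =>
    ∑ i ∈ Finset.range T.energy, c i.succPNat • current R ((i + 1 : ℕ) : ℤ) (single T 1)

lemma lowering_apply (c : ℕ+ → R) {N : ℕ} {v : Maya →₀ R} (hv : v ∈ energyLE R N) :
    lowering c v =
      ∑ i ∈ Finset.range N, c i.succPNat • current R ((i + 1 : ℕ) : ℤ) v := by
  refine energyLE_induction (p := fun v => lowering c v =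
      ∑ i ∈ Finset.range N, c i.succPNat • current R ((i + 1 : ℕ) : ℤ) v) ?_ ?_ ?_ hv
  · simp
  · intro v w h1 h2; rw [map_add, h1, h2, ← Finset.sum_add_distrib]; simp
  · intro T r hT
    rw [map_smul, lowering, linearCombination_single, one_smul]
    simp only [map_smul, smul_comm _ r, ← Finset.smul_sum]
    congr 1
    refine Finset.sum_subset (Finset.range_subset_range.2 hT) fun i _ hi => ?_
    rw [current_eq_zero (single_mem_energyLE le_rfl 1) (by simpa using hi), smul_zero]

lemma lowering_mem (c : ℕ+ → R) {N : ℕ} {v : Maya →₀ R} (hv : v ∈ energyLE R N) :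
    lowering c v ∈ energyLE R (N - 1) := by
  rw [lowering_apply c hv]
  exact Submodule.sum_mem _ fun i _ => Submodule.smul_mem _ _
    (energyLE_mono (by omega) (current_mem hv))

lemma lowering_pow_mem (c : ℕ+ → R) {N : ℕ} (n : ℕ) {v : Maya →₀ R} (hv : v ∈ energyLE R N) :
    (lowering c ^ n) v ∈ energyLE R (N - n) := by
  induction n with
  | zero => simpa using hv
  | succ n ih =>
    rw [pow_succ', Module.End.mul_apply, ← Nat.sub_sub]
    exact lowering_mem c ih

lemma lowering_pow_eq_zero (c : ℕ+ → R) {N : ℕ} {v : Maya →₀ R} (hv : v ∈ energyLE R N) {n : ℕ}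
    (hn : N < n) : (lowering c ^ n) v = 0 := by
  obtain ⟨n, rfl⟩ := Nat.exists_eq_succ_of_ne_zero (by omega : n ≠ 0)
  have h := lowering_pow_mem c n hv
  rw [Nat.sub_eq_zero_of_le (by omega)] at h
  rw [pow_succ', Module.End.mul_apply, lowering_apply c h]
  simp

lemma locallyNilpotent_lowering (c : ℕ+ → R) : LocallyNilpotent (lowering c) := fun v => by
  obtain ⟨N, hN⟩ := exists_mem_energyLE v
  exact ⟨N + 1, fun n hn => lowering_pow_eq_zero c hN (by omega)⟩

/-- The vertex operator `exp (∑_{k ≥ 1} c(k) J_k)`. -/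
def vertexOp (c : ℕ+ → R) : Module.End R (Maya →₀ R) :=
  locExp (lowering c) (locallyNilpotent_lowering c)

lemma vertexOp_mem (c : ℕ+ → R) {N : ℕ} {v : Maya →₀ R} (hv : v ∈ energyLE R N) :
    vertexOp c v ∈ energyLE R N := by
  rw [vertexOp, locExp_apply (N := N + 1) _ _ fun n hn => lowering_pow_eq_zero c hv (by omega)]
  refine Submodule.sum_mem _ fun n _ => ?_
  rw [algebra_compatible_smul R]
  exact Submodule.smul_mem _ _ (energyLE_mono (by omega) (lowering_pow_mem c n hv))

lemma lowering_comm_current (c : ℕ+ → R) {k : ℕ} (hk : 0 < k) :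
    lowering c * current R k = current R k * lowering c := by
  refine LinearMap.ext fun v => ?_
  obtain ⟨N, hN⟩ := exists_mem_energyLE v
  rw [Module.End.mul_apply, Module.End.mul_apply, lowering_apply c hN,
    lowering_apply c (energyLE_mono (Nat.sub_le N k) (current_mem (k := k) hN)), map_sum]
  refine Finset.sum_congr rfl fun i _ => ?_
  rw [map_smul, ← Module.End.mul_apply, current_comm (by omega) hk, Module.End.mul_apply]

lemma lowering_comm (c d : ℕ+ → R) : lowering c * lowering d = lowering d * lowering c := by
  refine LinearMap.ext fun v => ?_
  obtain ⟨N, hN⟩ := exists_mem_energyLE v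
  rw [Module.End.mul_apply, Module.End.mul_apply, lowering_apply d hN,
    lowering_apply d (energyLE_mono (Nat.sub_le N 1) (lowering_mem c hN)), map_sum]
  refine Finset.sum_congr rfl fun i _ => ?_
  rw [map_smul, ← Module.End.mul_apply, lowering_comm_current c (by omega), Module.End.mul_apply]

lemma J_transpose (k : ℤ) (S T : Maya) : J (-k) S T = J k T S := by
  rw [J, matEl, bilinear_transpose, neg_neg]; rfl

lemma current_entry_support (c : ℕ+ → R) (S T : Maya) (k : ℕ+)
    (hk : k ∉ (Finset.range T.energy).image Nat.succPNat) :
    c k * algebraMap ℝ R (J (k : ℤ) S T) = 0 := by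
  have : J (k : ℤ) S T = 0 := by
    by_contra h
    have := energy_of_bilinear_ne_zero h
    refine hk (Finset.mem_image.2 ⟨k - 1, ?_, PNat.eq ?_⟩)
    · rw [Finset.mem_range]; have := k.pos; omega
    · rw [Nat.succPNat_coe]; have := k.pos; omega
  rw [this, map_zero, mul_zero]

variable [TopologicalSpace R]

lemma currentSum_eq (c : ℕ+ → R) : currentSum c 1 = entries (lowering c) := by
  classical
  ext S T
  rw [currentSum, entries, lowering_apply c (single_mem_energyLE le_rfl 1),
    tsum_eq_sum (s := (Finset.range T.energy).image Nat.succPNat), Finset.sum_image,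
    Finsupp.finsetSum_apply]
  · refine Finset.sum_congr rfl fun i _ => ?_
    rw [Finsupp.smul_apply, smul_eq_mul, one_mul]
    congr 1
    exact (entries_extend _ _ _).symm
  · exact fun a _ b _ h => Nat.succPNat_injective h
  · intro k hk
    rw [one_mul]
    exact current_entry_support c S T k hk

lemma currentSum_neg_eq (c : ℕ+ → R) : currentSum c (-1) = (entries (lowering c)).transpose := by
  rw [← currentSum_eq]
  ext S T
  simp only [currentSum, Matrix.transpose_apply, neg_mul, one_mul, J_transpose]

lemma currentSummable_one (c : ℕ+ → R) : CurrentSummable c 1 := fun S T => by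
  classical
  refine summable_of_hasFiniteSupport
    (((Finset.range T.energy).image Nat.succPNat).finite_toSet.subset fun k hk => ?_)
  by_contra h
  exact hk (by simpa only [one_mul] using current_entry_support c S T k h)

lemma currentSummable_neg_one (c : ℕ+ → R) : CurrentSummable c (-1) := fun S T => by
  have := currentSummable_one c T S
  simp only [neg_mul, one_mul, J_transpose] at this ⊢
  exact this

lemma opExp_currentSum (c : ℕ+ → R) : opExp (currentSum c 1) = entries (vertexOp c) := by
  rw [currentSum_eq]; exact opExp_entries _

lemma opExp_currentSum_neg (c : ℕ+ → R) :
    opExp (currentSum c (-1)) = (entries (vertexOp c)).transpose := by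
  rw [currentSum_neg_eq]; exact opExp_entries_transpose _

lemma exponentiable_currentSum (c : ℕ+ → R) : Exponentiable (currentSum c 1) := by
  rw [currentSum_eq]; exact exponentiable_entries (locallyNilpotent_lowering c)

lemma exponentiable_currentSum_neg (c : ℕ+ → R) : Exponentiable (currentSum c (-1)) := by
  rw [currentSum_neg_eq]; exact exponentiable_entries_transpose (locallyNilpotent_lowering c)

end Current

/-! ### The coefficients of the shift polynomial -/

/-- The coefficient of `z^j` in `∏_{i < K} (1 - y_i z)` for `y_i = r^{2i + 1 - K}`. -/
def shiftCoeff (r : ℝ) (K j : ℕ) : ℝ :=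
  (-1) ^ j * MvPolynomial.aeval (fun i : Fin K => r ^ (2 * (i : ℤ) + 1 - K))
    (MvPolynomial.esymm (Fin K) ℝ j)

lemma shiftCoeff_eq_sum (r : ℝ) (K j : ℕ) : shiftCoeff r K j =
    (-1) ^ j * ∑ t ∈ Finset.powersetCard j (Finset.univ : Finset (Fin K)),
      ∏ i ∈ t, r ^ (2 * (i : ℤ) + 1 - K) := by
  rw [shiftCoeff, MvPolynomial.esymm, map_sum]
  simp

lemma shiftCoeff_zero (r : ℝ) (K : ℕ) : shiftCoeff r K 0 = 1 := by
  simp [shiftCoeff]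

lemma shiftCoeff_eq_zero (r : ℝ) {K j : ℕ} (h : K < j) : shiftCoeff r K j = 0 := by
  rw [shiftCoeff_eq_sum, Finset.powersetCard_eq_empty.2 (by simpa using h)]
  simp

/-- The shift polynomial is palindromic up to sign, because the numbers `y_i` are permuted by
`y ↦ 1/y`. -/
lemma shiftCoeff_symm {r : ℝ} (hr : 0 < r) {K j : ℕ} (h : j ≤ K) :
    (-1) ^ K * shiftCoeff r K (K - j) = shiftCoeff r K j := by
  set y : Fin K → ℝ := fun i => r ^ (2 * (i : ℤ) + 1 - K) with hy
  have hrev : ∀ i : Fin K, y i.rev = (y i)⁻¹ := by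
    intro i
    simp only [hy]
    rw [← zpow_neg]
    congr 1
    rw [Fin.val_rev]
    have := i.isLt
    push_cast [Nat.cast_sub (show (i : ℕ) + 1 ≤ K by omega)]
    ring
  have hne : ∀ i, y i ≠ 0 := fun i => (zpow_pos hr _).ne'
  have hprod : ∏ i, y i = 1 := by
    have h1 : ∏ i, y i = ∏ i, (y i)⁻¹ := by
      rw [← Equiv.prod_comp Fin.revPerm y]
      exact Finset.prod_congr rfl fun i _ => hrev i
    have h2 : 0 < ∏ i, y i := Finset.prod_pos fun i _ => zpow_pos hr _
    rw [Finset.prod_inv_distrib] at h1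
    have h3 : (∏ i, y i) * ∏ i, y i = 1 := by
      nth_rewrite 2 [h1]; exact mul_inv_cancel₀ h2.ne'
    nlinarith
  have hsum : ∑ t ∈ Finset.powersetCard (K - j) (Finset.univ : Finset (Fin K)), ∏ i ∈ t, y i =
      ∑ t ∈ Finset.powersetCard j (Finset.univ : Finset (Fin K)), ∏ i ∈ t, y i := by
    refine Finset.sum_nbij' (fun t => (t.map Fin.revPerm.toEmbedding)ᶜ)
      (fun t => (t.map Fin.revPerm.toEmbedding)ᶜ) ?_ ?_ ?_ ?_ ?_
    · intro t ht
      rw [Finset.mem_powersetCard_univ] at ht ⊢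
      rw [Finset.card_compl, Finset.card_map, Fintype.card_fin]; omega
    · intro t ht
      rw [Finset.mem_powersetCard_univ] at ht ⊢
      rw [Finset.card_compl, Finset.card_map, Fintype.card_fin]; omega
    · intro t _; ext i; simp
    · intro t _; ext i; simp
    · intro t _
      have h1 := Finset.prod_mul_prod_compl (t.map Fin.revPerm.toEmbedding) y
      rw [hprod, Finset.prod_map] at h1
      simp only [Equiv.coe_toEmbedding, Fin.revPerm_apply, hrev, Finset.prod_inv_distrib] at h1
      have h2 : ∏ i ∈ t, y i ≠ 0 := Finset.prod_ne_zero_iff.2 fun i _ => hne i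
      field_simp at h1
      exact h1.symm
  rw [shiftCoeff_eq_sum, shiftCoeff_eq_sum, hsum, ← mul_assoc, ← pow_add]
  congr 1
  rw [show K + (K - j) = j + 2 * (K - j) by omega, pow_add, pow_mul]
  simp

/-- Newton's identity for the shift polynomial. -/
lemma shiftCoeff_newton (r : ℝ) (K n : ℕ) :
    (n : ℝ) * shiftCoeff r K n =
      -∑ j ∈ Finset.range n, shiftCoeff r K j * ∑ i : Fin K, (r ^ (2 * (i : ℤ) + 1 - K)) ^ (n - j) := by
  have h := congrArg (MvPolynomial.aeval fun i : Fin K => r ^ (2 * (i : ℤ) + 1 - K))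
    (MvPolynomial.mul_esymm_eq_sum (Fin K) ℝ n)
  simp only [map_mul, map_natCast, map_pow, map_neg, map_one, map_sum] at h
  rw [shiftCoeff, mul_left_comm, h, Finset.sum_filter,
    Finset.Nat.sum_antidiagonal_eq_sum_range_succ_mk, Finset.sum_range_succ]
  simp only [lt_self_iff_false, if_false, add_zero]
  rw [← mul_assoc, ← pow_add, show n + (n + 1) = 2 * n + 1 by ring, pow_succ, pow_mul]
  rw [neg_one_sq, one_pow, one_mul, neg_one_mul]
  congr 1
  refine Finset.sum_congr rfl fun j hj => ?_
  rw [if_pos (Finset.mem_range.1 hj), shiftCoeff, MvPolynomial.psum, map_sum]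
  simp

/-- The power sums of the `y_i` are geometric series; up to sign they are the products of the
coefficients of the vertex operator with the structure constants `r^{Kk} - r^{-Kk}`. -/
lemma sum_shift_pow {r : ℝ} (hr0 : 0 < r) (hr1 : r < 1) (K : ℕ) {k : ℕ} (hk : 0 < k) :
    ∑ i : Fin K, (r ^ (2 * (i : ℤ) + 1 - K)) ^ k =
      -(r ^ k / (1 - r ^ (2 * k)) * ((r ^ K) ^ k - ((r ^ K) ^ k)⁻¹)) := by
  have hlt : r ^ (2 * k) < 1 := pow_lt_one₀ hr0.le hr1 (by omega)
  have h1 : ∀ i : Fin K, (r ^ (2 * (i : ℤ) + 1 - K)) ^ k =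
      r ^ k * ((r ^ K) ^ k)⁻¹ * (r ^ (2 * k)) ^ (i : ℕ) := by
    intro i
    have h : r ^ (2 * (i : ℤ) + 1 - K) = r ^ (2 * (i : ℕ)) * r * (r ^ K)⁻¹ := by
      rw [zpow_sub₀ hr0.ne', zpow_add₀ hr0.ne', zpow_one, div_eq_mul_inv]
      norm_cast
    rw [h, mul_pow, mul_pow, inv_pow]
    ring
  rw [Finset.sum_congr rfl fun i _ => h1 i, ← Finset.mul_sum,
    Fin.sum_univ_eq_sum_range (fun i => (r ^ (2 * k)) ^ i) K, geom_sum_eq hlt.ne]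
  have : (r ^ (2 * k)) ^ K = (r ^ K) ^ k * (r ^ K) ^ k := by ring
  rw [this]
  have h2 : (r ^ K) ^ k ≠ 0 := by positivity
  have h3 : r ^ (2 * k) - 1 ≠ 0 := by linarith
  have h4 : 1 - r ^ (2 * k) ≠ 0 := by linarith
  field_simp
  ring

/-! ### The shift symmetry -/

lemma bilinear_smul (a : ℝ) (c : ℤ → ℝ) (m : ℤ) (v : Fock) :
    bilinear (fun n => a * c n) m v = a • bilinear c m v := by
  rw [bilinear_apply, bilinear_apply, smul_finsum' _ (finite_smul_normalOrd c m v)]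
  exact finsum_congr fun n => mul_smul _ _ _

/-- The operator `V_m = s^{-m} ∑_n s^{2n} c†_{n-m} c_n`, where the divergent sum for `m = 0` is
regularised by geometric continuation, `∑_{n ≤ 0} s^{2n} = -s²/(1 - s²)`. With `s = q^{k/2}` this
is `V^{(k)}_m - δ_{m,0} q^k/(1 - q^k)` in the quantum torus algebra. -/
def torus (s : ℝ) (m : ℤ) : Module.End ℝ Fock :=
  s ^ (-m) • (bilinear (fun n => s ^ (2 * n)) m -
    (if m = 0 then s ^ 2 / (1 - s ^ 2) else 0) • (1 : Module.End ℝ Fock))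

lemma torus_apply (s : ℝ) (m : ℤ) (v : Fock) :
    torus s m v = s ^ (-m) • (bilinear (fun n => s ^ (2 * n)) m v -
      (if m = 0 then s ^ 2 / (1 - s ^ 2) else 0) • v) := rfl

lemma torus_transpose {s : ℝ} (hs : 0 < s) (m : ℤ) (S T : Maya) :
    torus s m (single T 1) S = torus s (-m) (single S 1) T := by
  classical
  rw [torus_apply, torus_apply, Finsupp.smul_apply, Finsupp.smul_apply, Finsupp.sub_apply,
    Finsupp.sub_apply, bilinear_transpose]
  rcases eq_or_ne m 0 with rfl | hm
  · simp [single_apply, eq_comm]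
  · simp only [hm, neg_eq_zero, if_false, zero_smul, Finsupp.zero_apply, sub_zero, neg_neg,
      smul_eq_mul]
    have : (fun n : ℤ => s ^ (2 * (n + m))) = fun n => s ^ (2 * m) * s ^ (2 * n) := by
      funext n; rw [← zpow_add₀ hs.ne']; congr 1; ring
    rw [this, bilinear_smul, Finsupp.smul_apply, smul_eq_mul, ← mul_assoc, ← zpow_add₀ hs.ne']
    congr 2; ring

lemma energy_of_torus_ne_zero {s : ℝ} {m : ℤ} {S T : Maya}
    (h : torus s m (single T 1) S ≠ 0) : (T.energy : ℤ) = S.energy + m := by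
  classical
  by_contra hE
  refine h ?_
  have h1 : bilinear (fun n => s ^ (2 * n)) m (single T 1) S = 0 := by
    by_contra h'; exact hE (energy_of_bilinear_ne_zero h')
  rw [torus_apply, Finsupp.smul_apply, Finsupp.sub_apply, h1]
  rcases eq_or_ne m 0 with rfl | hm
  · have : T ≠ S := by rintro rfl; simp at hE
    simp [this]
  · simp [hm]

lemma current_real (k : ℤ) : current ℝ k = bilinear (fun _ => 1) k := extend_real _

lemma geom_sum_Ioc {s : ℝ} (hs0 : 0 < s) (hs1 : s < 1) (k : ℕ) :
    ∑ n ∈ Finset.Ioc (-(k : ℤ)) 0, s ^ (2 * n) = -((1 - s ^ (-2 * (k : ℤ))) * (s ^ 2 / (1 - s ^ 2))) := by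
  have h2 : 1 - s ^ 2 ≠ 0 := by nlinarith
  induction k with
  | zero => simp
  | succ k ih =>
    have : Finset.Ioc (-((k + 1 : ℕ) : ℤ)) 0 = insert (-(k : ℤ)) (Finset.Ioc (-(k : ℤ)) 0) := by
      ext n; simp only [Finset.mem_Ioc, Finset.mem_insert]; push_cast; omega
    rw [this, Finset.sum_insert (by simp), ih]
    have e : s ^ (-2 * ((k + 1 : ℕ) : ℤ)) = s ^ (2 * -(k : ℤ)) * (s ^ 2)⁻¹ := by
      rw [← zpow_natCast, ← zpow_neg, ← zpow_add₀ hs0.ne']; congr 1; push_cast; ring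
    have e' : s ^ (-2 * (k : ℤ)) = s ^ (2 * -(k : ℤ)) := by congr 1; ring
    rw [e, e']
    field_simp
    ring

/-- The quantum torus relation `[J_k, V_m] = (s^k - s^{-k}) V_{m+k}`; the regularisation of `V_0`
absorbs the central term. -/
lemma current_torus_comm {s : ℝ} (hs0 : 0 < s) (hs1 : s < 1) {k : ℕ} (hk : 0 < k) (m : ℤ) (v : Fock) :
    current ℝ k (torus s m v) =
      torus s m (current ℝ k v) + (s ^ k - (s ^ k)⁻¹) • torus s (m + k) v := by
  rw [current_real]
  have h := current_bilinear_comm (l := k) (by exact_mod_cast hk) (fun n => s ^ (2 * n)) m v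
  have hc : (fun n : ℤ => s ^ (2 * n) - s ^ (2 * (n - k))) =
      fun n => (1 - s ^ (-2 * (k : ℤ))) * s ^ (2 * n) := by
    funext n
    rw [sub_mul, one_mul, ← zpow_add₀ hs0.ne']
    congr 2; ring
  rw [hc, bilinear_smul, geom_sum_Ioc hs0 hs1] at h
  have hs : s ^ (-m) * (1 - s ^ (-2 * (k : ℤ))) = (s ^ k - (s ^ k)⁻¹) * s ^ (-(m + k)) := by
    rw [← zpow_natCast, ← zpow_neg, mul_sub, sub_mul, mul_one, ← zpow_add₀ hs0.ne',
      ← zpow_add₀ hs0.ne', ← zpow_add₀ hs0.ne']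
    congr 2 <;> ring
  rw [torus_apply, torus_apply, torus_apply, map_smul, map_sub, map_smul, smul_smul, ← hs,
    ← smul_smul, ← smul_add]
  congr 1
  rw [sub_eq_iff_eq_add] at h
  rw [h]
  split_ifs <;> module

/-- The energy operator `L_0`. -/
def energyOp : Module.End ℝ Fock := bilinear (fun n => (n : ℝ)) 0

lemma energyOp_apply (v : Fock) (S : Maya) : energyOp v S = S.energy * v S := by
  classical
  induction v using Finsupp.induction_linear with
  | zero => simp
  | add v w hv hw => rw [map_add, Finsupp.add_apply, hv, hw, Finsupp.add_apply, mul_add]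
  | single T r =>
    rw [energyOp, bilinear_zero_single, Finsupp.smul_apply, Maya.wt_id, smul_eq_mul, single_apply]
    split_ifs with h
    · rw [h]
    · simp

/-- An operator all of whose matrix elements lower the energy by `m` has degree `m` with respect to
`L_0`. -/
lemma energyOp_comm {A : Module.End ℝ Fock} {m : ℤ}
    (hA : ∀ S T : Maya, A (single T 1) S ≠ 0 → (T.energy : ℤ) = S.energy + m) (v : Fock) :
    energyOp (A v) = A (energyOp v) - (m : ℝ) • A v := by
  ext S
  have hsub : (energyOp v).support ⊆ v.support := fun T hT => by
    rw [mem_support_iff, energyOp_apply] at hT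
    exact mem_support_iff.2 (right_ne_zero_of_mul hT)
  rw [energyOp_apply, Finsupp.sub_apply, Finsupp.smul_apply, apply_eq_sum A v,
    apply_eq_sum_of_subset A _ S hsub, smul_eq_mul, Finset.mul_sum, Finset.mul_sum,
    ← Finset.sum_sub_distrib]
  refine Finset.sum_congr rfl fun T _ => ?_
  rw [energyOp_apply]
  by_cases h : A (single T 1) S = 0
  · simp [h]
  · have : (T.energy : ℝ) = S.energy + m := by exact_mod_cast hA S T h
    rw [this]; ring

/-- Multiplication of the coefficient of `J_k` by `k`. -/
def weighted (c : ℕ+ → ℝ) : ℕ+ → ℝ := fun k => (k : ℝ) * c k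

lemma energyOp_lowering (c : ℕ+ → ℝ) (v : Fock) :
    energyOp (lowering c v) = lowering c (energyOp v) - lowering (weighted c) v := by
  obtain ⟨N, hN⟩ := exists_mem_energyLE v
  have hN' : energyOp v ∈ energyLE ℝ N := by
    rw [energyLE, mem_supported] at hN ⊢
    refine fun T hT => hN (mem_support_iff.2 fun h => mem_support_iff.1 hT ?_)
    rw [energyOp_apply, h, mul_zero]
  rw [lowering_apply c hN, lowering_apply c hN', lowering_apply _ hN, map_sum,
    ← Finset.sum_sub_distrib]
  refine Finset.sum_congr rfl fun i _ => ?_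
  rw [map_smul, current_real, energyOp_comm fun S T => energy_of_bilinear_ne_zero]
  rw [weighted, smul_sub, smul_smul, Nat.succPNat_coe, mul_comm (c _)]
  rfl

/-- `L_0 G = G L_0 - (∑_k k c_k J_k) G`: the grading of a vertex operator. -/
lemma energyOp_vertexOp (c : ℕ+ → ℝ) (v : Fock) :
    energyOp (vertexOp c v) = vertexOp c (energyOp v) - vertexOp c (lowering (weighted c) v) := by
  have h := comm_locExp (B := -lowering (weighted c)) (locallyNilpotent_lowering c) energyOp
    (fun v => by rw [energyOp_lowering, LinearMap.neg_apply, sub_eq_add_neg])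
    (by rw [mul_neg, neg_mul, lowering_comm]) v
  rw [vertexOp, h, LinearMap.neg_apply, map_neg, sub_eq_add_neg]

lemma vertexOp_lowering (c d : ℕ+ → ℝ) (v : Fock) :
    vertexOp c (lowering d v) = lowering d (vertexOp c v) := by
  have h := comm_locExp (B := 0) (locallyNilpotent_lowering c) (lowering d)
    (fun v => by
      have := LinearMap.congr_fun (lowering_comm c d) v
      simpa using this.symm) (by simp) v
  simpa [vertexOp] using h.symm

/-- An operator of degree `m` takes vectors of energy at most `N` to energy at most `N - m`. -/
lemma energy_add_le_of_apply_ne_zero {A : Module.End ℝ Fock} {m : ℤ}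
    (hA : ∀ S T : Maya, A (single T 1) S ≠ 0 → (T.energy : ℤ) = S.energy + m) {N : ℕ} {v : Fock}
    (hv : v ∈ energyLE ℝ N) {S : Maya} (h : A v S ≠ 0) : (S.energy : ℤ) + m ≤ N := by
  rw [apply_eq_sum] at h
  obtain ⟨T, hT, hT'⟩ := Finset.exists_ne_zero_of_sum_ne_zero h
  rw [← hA S T (left_ne_zero_of_mul hT')]
  exact_mod_cast (mem_supported _ _).1 hv hT

lemma torus_eq_zero {s : ℝ} {m : ℤ} {N : ℕ} {v : Fock} (hv : v ∈ energyLE ℝ N) (h : (N : ℤ) < m) :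
    torus s m v = 0 := by
  ext S
  by_contra h'
  have := energy_add_le_of_apply_ne_zero (fun S T => energy_of_torus_ne_zero) hv h'
  omega

lemma torus_mem {s : ℝ} {m : ℤ} {N M : ℕ} {v : Fock} (hv : v ∈ energyLE ℝ N)
    (h : (N : ℤ) ≤ M + m) : torus s m v ∈ energyLE ℝ M := by
  rw [energyLE, mem_supported]
  intro S hS
  have := energy_add_le_of_apply_ne_zero (fun S T => energy_of_torus_ne_zero) hv
    (mem_support_iff.1 hS)
  simp only [Set.mem_ofPred_eq]; omega

lemma lowering_torus (c : ℕ+ → ℝ) {s : ℝ} (hs0 : 0 < s) (hs1 : s < 1) (m : ℤ) {N M : ℕ} {v : Fock}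
    (hv : v ∈ energyLE ℝ N) (hM : (N : ℤ) ≤ M + m) (hM' : N ≤ M) :
    lowering c (torus s m v) = torus s m (lowering c v) +
      ∑ i ∈ Finset.range M, (c i.succPNat * (s ^ (i + 1) - (s ^ (i + 1))⁻¹)) •
        torus s (m + (i + 1 : ℕ)) v := by
  rw [lowering_apply c (torus_mem hv hM), lowering_apply c (energyLE_mono hM' hv), map_sum,
    ← Finset.sum_add_distrib]
  refine Finset.sum_congr rfl fun i _ => ?_
  rw [current_torus_comm hs0 hs1 (by omega), smul_add, map_smul, smul_smul]

/-- `lowering` strictly lowers the energy. -/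
lemma lowering_apply_top {R : Type*} [CommRing R] [Algebra ℝ R] (c : ℕ+ → R) {N : ℕ}
    {v : Maya →₀ R} (hv : v ∈ energyLE R N) {S : Maya} (hS : N ≤ S.energy) :
    lowering c v S = 0 := by
  rcases Nat.eq_zero_or_pos N with rfl | hN
  · rw [lowering_apply c hv]; simp
  · by_contra h
    have := (mem_supported _ _).1 (lowering_mem c hv) (mem_support_iff.2 h)
    simp only [Set.mem_ofPred_eq] at this
    omega

/-- A vertex operator does not change the components of highest energy. -/
lemma vertexOp_apply_top {R : Type*} [CommRing R] [Algebra ℝ R] (c : ℕ+ → R) {N : ℕ}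
    {v : Maya →₀ R} (hv : v ∈ energyLE R N) {S : Maya} (hS : N ≤ S.energy) :
    vertexOp c v S = v S := by
  rw [vertexOp, locExp_apply (N := N + 1) _ _ fun n hn => lowering_pow_eq_zero c hv (by omega),
    Finset.sum_range_succ', Finsupp.add_apply, Finsupp.finsetSum_apply, Finset.sum_eq_zero]
  · simp
  · intro n _
    rw [pow_succ', Module.End.mul_apply, Finsupp.smul_apply,
      lowering_apply_top c (energyLE_mono (Nat.sub_le N n) (lowering_pow_mem c n hv)) hS, smul_zero]

/-- A recursion `n e_n = ∑_{j < n} e_j p_{n - j}`, summed against a finitely supported sequence. -/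
lemma sum_recursion {M : Type*} [AddCommGroup M] [Module ℝ M] {e p : ℕ → ℝ} {K L : ℕ} {F : ℕ → M}
    (he : ∀ n : ℕ, (n : ℝ) * e n = ∑ j ∈ Finset.range n, e j * p (n - j))
    (heK : ∀ j, K < j → e j = 0) (hF : ∀ n, L ≤ n → F n = 0) (hL : K < L) :
    ∑ j ∈ Finset.range (K + 1), e j • ∑ i ∈ Finset.range L, p (i + 1) • F (j + (i + 1)) =
      ∑ j ∈ Finset.range (K + 1), ((j : ℝ) * e j) • F j := by
  have h1 : ∀ j, ∑ i ∈ Finset.range L, p (i + 1) • F (j + (i + 1)) =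
      ∑ n ∈ Finset.range L, if j < n then p (n - j) • F n else 0 := by
    intro j
    rw [← Finset.sum_filter]
    have h2 : ∑ i ∈ Finset.range L, p (i + 1) • F (j + (i + 1)) =
        ∑ n ∈ Finset.Ico (j + 1) (L + (j + 1)), p (n - j) • F n := by
      rw [Finset.sum_Ico_eq_sum_range, Nat.add_sub_cancel]
      refine Finset.sum_congr rfl fun i _ => ?_
      congr 2 <;> omega
    rw [h2]
    symm
    refine Finset.sum_subset (fun n hn => ?_) fun n hn hn' => ?_
    · rw [Finset.mem_filter, Finset.mem_range] at hn
      rw [Finset.mem_Ico]; omega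
    · rw [Finset.mem_filter, Finset.mem_range] at hn'
      rw [Finset.mem_Ico] at hn
      rw [hF n (by omega), smul_zero]
  have hsub : Finset.range (K + 1) ⊆ Finset.range L := Finset.range_subset_range.2 hL
  have hz : ∀ j ∈ Finset.range L, j ∉ Finset.range (K + 1) → e j = 0 := fun j _ hj =>
    heK j (by simpa using hj)
  rw [Finset.sum_subset hsub fun j hj hj' => by rw [hz j hj hj', zero_smul],
    Finset.sum_subset hsub fun j hj hj' => by rw [hz j hj hj', mul_zero, zero_smul]]
  simp only [h1, Finset.smul_sum]
  rw [Finset.sum_comm]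
  refine Finset.sum_congr rfl fun n hn => ?_
  rw [he, Finset.sum_smul]
  have hsub' : Finset.range n ⊆ Finset.range L :=
    Finset.range_subset_range.2 (Finset.mem_range.1 hn).le
  rw [← Finset.sum_subset hsub']
  · refine Finset.sum_congr rfl fun j hj => ?_
    rw [if_pos (Finset.mem_range.1 hj), smul_smul]
  · intro j _ hj
    rw [if_neg (by simpa using hj), smul_zero]

/-- The coefficients `x^{k/2} / (k (1 - x^k))` for `x = r²`. -/
def rootCoeff (r : ℝ) (k : ℕ+) : ℝ := r ^ (k : ℕ) / ((k : ℝ) * (1 - r ^ (2 * (k : ℕ))))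

lemma shiftCoeff_recursion {r : ℝ} (hr0 : 0 < r) (hr1 : r < 1) (K n : ℕ) :
    (n : ℝ) * shiftCoeff r K n = ∑ j ∈ Finset.range n, shiftCoeff r K j *
      (r ^ (n - j) / (1 - r ^ (2 * (n - j))) *
        ((r ^ K) ^ (n - j) - ((r ^ K) ^ (n - j))⁻¹)) := by
  rw [shiftCoeff_newton, ← Finset.sum_neg_distrib]
  refine Finset.sum_congr rfl fun j hj => ?_
  rw [sum_shift_pow hr0 hr1 K (by have := Finset.mem_range.1 hj; omega)]
  ring

/-- Conjugation by the vertex operator `G_+` multiplies the generating function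
`∑_m V_m z^{-m}` by the shift polynomial. Both sides satisfy the same first order differential
equation with respect to the energy grading, and they agree to leading order. -/
theorem vertexOp_torus {r : ℝ} (hr0 : 0 < r) (hr1 : r < 1) {K : ℕ} (hK : 0 < K) (m : ℤ) (v : Fock) :
    vertexOp (rootCoeff r) (torus (r ^ K) m v) =
      ∑ j ∈ Finset.range (K + 1), shiftCoeff r K j •
        torus (r ^ K) (m + j) (vertexOp (rootCoeff r) v) := by
  obtain ⟨c, hc⟩ : ∃ c, c = rootCoeff r := ⟨_, rfl⟩
  obtain ⟨s, hs⟩ : ∃ s, s = r ^ K := ⟨_, rfl⟩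
  have hs0 : 0 < s := hs ▸ pow_pos hr0 K
  have hs1 : s < 1 := hs ▸ pow_lt_one₀ hr0.le hr1 hK.ne'
  obtain ⟨G, hG⟩ : ∃ G, G = vertexOp c := ⟨_, rfl⟩
  rw [← hs, ← hc, ← hG]
  obtain ⟨Y, hY⟩ : ∃ Y : Module.End ℝ Fock, Y = G * torus s m -
    ∑ j ∈ Finset.range (K + 1), shiftCoeff r K j • (torus s (m + j) * G) := ⟨_, rfl⟩
  have hYv : ∀ v, Y v = G (torus s m v) -
      ∑ j ∈ Finset.range (K + 1), shiftCoeff r K j • torus s (m + j) (G v) := by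
    intro v
    rw [hY, LinearMap.sub_apply, LinearMap.sum_apply]
    rfl
  -- the differential equation
  have hode : ∀ v, energyOp (Y v) = Y (energyOp v) - (m : ℝ) • Y v - lowering (weighted c) (Y v) := by
    intro v
    have hL : ∀ (n : ℤ) (w : Fock), energyOp (torus s n w) =
        torus s n (energyOp w) - (n : ℝ) • torus s n w := fun n w =>
      energyOp_comm (fun S T => energy_of_torus_ne_zero) w
    have hGL : ∀ w, energyOp (G w) = G (energyOp w) - lowering (weighted c) (G w) := fun w => by
      rw [hG, energyOp_vertexOp, vertexOp_lowering]
    obtain ⟨N, hN⟩ := exists_mem_energyLE (G v)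
    obtain ⟨L, hLdef⟩ : ∃ L, L = N + m.natAbs + K + 1 := ⟨_, rfl⟩
    have hT : ∀ j : ℕ, lowering (weighted c) (torus s (m + j) (G v)) =
        torus s (m + j) (lowering (weighted c) (G v)) +
          ∑ i ∈ Finset.range L, (r ^ (i + 1) / (1 - r ^ (2 * (i + 1))) *
            (s ^ (i + 1) - (s ^ (i + 1))⁻¹)) • torus s (m + (j + (i + 1) : ℕ)) (G v) := by
      intro j
      rw [lowering_torus _ hs0 hs1 _ hN (M := L) (by omega) (by omega)]
      refine congrArg _ (Finset.sum_congr rfl fun i _ => ?_)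
      have e1 : weighted c i.succPNat = r ^ (i + 1) / (1 - r ^ (2 * (i + 1))) := by
        rw [weighted, hc, rootCoeff, Nat.succPNat_coe, Nat.succ_eq_add_one]
        have : ((i + 1 : ℕ) : ℝ) ≠ 0 := by positivity
        rw [mul_div_assoc', mul_div_mul_left _ _ this]
      have e2 : m + (j : ℤ) + ((i + 1 : ℕ) : ℤ) = m + ((j + (i + 1) : ℕ) : ℤ) := by
        push_cast; ring
      rw [e1, e2]
    have hF : ∀ n : ℕ, L ≤ n → torus s (m + n) (G v) = 0 := fun n hn =>
      torus_eq_zero hN (by omega)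
    have hrec := sum_recursion (K := K)
      (p := fun k => r ^ k / (1 - r ^ (2 * k)) * (s ^ k - (s ^ k)⁻¹))
      (F := fun n => torus s (m + n) (G v)) (L := L)
      (fun n => hs ▸ shiftCoeff_recursion hr0 hr1 K n) (fun j => shiftCoeff_eq_zero r)
      hF (by omega)
    rw [hYv v, hYv (energyOp v), map_sub, hGL, hL, map_sub, map_smul, map_sub, map_sum, map_sum]
    have hA : ∑ j ∈ Finset.range (K + 1),
          energyOp (shiftCoeff r K j • torus s (m + j) (G v)) =
        ∑ j ∈ Finset.range (K + 1), shiftCoeff r K j • torus s (m + j) (G (energyOp v)) -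
          ∑ j ∈ Finset.range (K + 1), lowering (weighted c)
            (shiftCoeff r K j • torus s (m + j) (G v)) -
          (m : ℝ) • ∑ j ∈ Finset.range (K + 1), shiftCoeff r K j • torus s (m + j) (G v) := by
      have h1 : ∀ j ∈ Finset.range (K + 1), energyOp (shiftCoeff r K j • torus s (m + j) (G v)) =
          shiftCoeff r K j • torus s (m + j) (G (energyOp v)) -
          lowering (weighted c) (shiftCoeff r K j • torus s (m + j) (G v)) -
          (m : ℝ) • (shiftCoeff r K j • torus s (m + j) (G v)) +
          (shiftCoeff r K j • ∑ i ∈ Finset.range L, (r ^ (i + 1) / (1 - r ^ (2 * (i + 1))) *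
            (s ^ (i + 1) - (s ^ (i + 1))⁻¹)) • torus s (m + (j + (i + 1) : ℕ)) (G v) -
          ((j : ℝ) * shiftCoeff r K j) • torus s (m + j) (G v)) := by
        intro j _
        rw [map_smul, map_smul, hL, hGL, hT, map_sub]
        push_cast
        module
      rw [Finset.sum_congr rfl h1, Finset.sum_add_distrib, Finset.sum_sub_distrib,
        Finset.sum_sub_distrib, Finset.sum_sub_distrib, hrec, sub_self, add_zero, Finset.smul_sum]
    rw [hA]
    module
  -- a nonzero vector in the image has no admissible component of highest energy
  have hzero : Y = 0 := by
    refine lhom_ext' fun T => LinearMap.ext_ring ?_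
    rw [LinearMap.comp_apply, lsingle_apply, LinearMap.comp_apply, LinearMap.zero_apply]
    by_contra hne
    obtain ⟨S, hS, hmax⟩ := Finset.exists_max_image (Y (single T 1)).support Maya.energy
      (support_nonempty_iff.2 hne)
    have hmem : Y (single T 1) ∈ energyLE ℝ S.energy := (mem_supported _ _).2 hmax
    have hLT : energyOp (single T 1) = (T.energy : ℝ) • single T 1 := by
      rw [energyOp, bilinear_zero_single, Maya.wt_id]
    have h1 := DFunLike.congr_fun (hode (single T 1)) S
    rw [hLT, map_smul, energyOp_apply, Finsupp.sub_apply, Finsupp.sub_apply, Finsupp.smul_apply,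
      Finsupp.smul_apply, lowering_apply_top _ hmem le_rfl, sub_zero, smul_eq_mul, smul_eq_mul,
      ← sub_mul] at h1
    have h2 := mul_right_cancel₀ (mem_support_iff.1 hS) h1
    have hE : (T.energy : ℤ) = S.energy + m := by
      have : (T.energy : ℝ) = S.energy + m := by linarith
      exact_mod_cast this
    refine mem_support_iff.1 hS ?_
    have hT1 : single T (1 : ℝ) ∈ energyLE ℝ T.energy := single_mem_energyLE le_rfl 1
    have hGT : G (single T 1) ∈ energyLE ℝ T.energy := hG ▸ vertexOp_mem c hT1
    rw [hYv, Finsupp.sub_apply, Finsupp.finsetSum_apply,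
      hG, vertexOp_apply_top c (torus_mem hT1 (by omega)) le_rfl, ← hG, Finset.sum_range_succ']
    rw [Finset.sum_eq_zero, zero_add, shiftCoeff_zero, one_smul, sub_eq_zero, Nat.cast_zero,
      add_zero]
    · have h3 : torus s m (G (single T 1) - single T 1) S = 0 := by
        rw [apply_eq_sum]
        refine Finset.sum_eq_zero fun U hU => ?_
        by_contra h
        have := energy_of_torus_ne_zero (left_ne_zero_of_mul h)
        refine right_ne_zero_of_mul h ?_
        rw [Finsupp.sub_apply, hG, vertexOp_apply_top c hT1 (by omega), sub_self]
      rw [map_sub, Finsupp.sub_apply, sub_eq_zero] at h3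
      exact h3.symm
    · intro j _
      by_contra h
      rw [Finsupp.smul_apply] at h
      have := energy_add_le_of_apply_ne_zero (fun S T => energy_of_torus_ne_zero) hGT
        (right_ne_zero_of_mul h)
      push_cast at this
      omega
  have := hYv v
  rw [hzero, LinearMap.zero_apply] at this
  exact (sub_eq_zero.1 this.symm)

/-! ### The Gram matrix of a vertex operator -/

/-- The bilinear form for which the Maya diagrams are orthonormal. -/
def dot : Fock →ₗ[ℝ] Fock →ₗ[ℝ] ℝ := linearCombination ℝ fun S => lapply S

lemma dot_single (S : Maya) (v : Fock) : dot (single S 1) v = v S := by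
  rw [dot, linearCombination_single, one_smul, lapply_apply]

lemma dot_eq_sum (u v : Fock) {I : Finset Maya} (hI : u.support ⊆ I) :
    dot u v = ∑ S ∈ I, u S * v S := by
  rw [dot, linearCombination_apply, Finsupp.sum_of_support_subset _ hI _ (by simp),
    LinearMap.sum_apply]
  rfl

lemma dot_comm (u v : Fock) : dot u v = dot v u := by
  classical
  rw [dot_eq_sum u v (I := u.support ∪ v.support) Finset.subset_union_left,
    dot_eq_sum v u (I := u.support ∪ v.support) Finset.subset_union_right]
  exact Finset.sum_congr rfl fun S _ => mul_comm _ _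

lemma dot_adjoint {A B : Module.End ℝ Fock}
    (h : ∀ S T, A (single T 1) S = B (single S 1) T) (u v : Fock) :
    dot (A u) v = dot u (B v) := by
  have : dot ∘ₗ A = dot.compl₂ B := by
    refine lhom_ext' fun T => LinearMap.ext_ring (lhom_ext' fun S => LinearMap.ext_ring ?_)
    simp only [LinearMap.comp_apply, lsingle_apply, LinearMap.compl₂_apply]
    rw [dot_comm, dot_single, dot_single, h]
  exact LinearMap.congr_fun (LinearMap.congr_fun this u) v

lemma dot_current (k : ℤ) (u v : Fock) :
    dot (current ℝ k u) v = dot u (current ℝ (-k) v) := by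
  rw [current_real, current_real]
  exact dot_adjoint (fun S T => bilinear_transpose _ _ _ _) u v

lemma dot_torus {s : ℝ} (hs : 0 < s) (m : ℤ) (u v : Fock) :
    dot (torus s m u) v = dot u (torus s (-m) v) :=
  dot_adjoint (torus_transpose hs m) u v

/-- The shift symmetry: the operator `G_- G_+`, which is the Gram matrix of `G_+`, intertwines
`V_K` with `(-1)^K V_0`. Moving `V_{-K}` out of the left factor produces the shift polynomial, and
by its palindromic symmetry the adjoint expression moves back into the right factor. -/
theorem dot_vertexOp_torus {r : ℝ} (hr0 : 0 < r) (hr1 : r < 1) {K : ℕ} (hK : 0 < K) (u v : Fock) :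
    dot (vertexOp (rootCoeff r) (torus (r ^ K) (-K) u)) (vertexOp (rootCoeff r) v) =
      (-1) ^ K * dot (vertexOp (rootCoeff r) u)
        (vertexOp (rootCoeff r) (torus (r ^ K) 0 v)) := by
  rw [vertexOp_torus hr0 hr1 hK, vertexOp_torus hr0 hr1 hK, map_sum, LinearMap.sum_apply, map_sum,
    Finset.mul_sum, ← Finset.sum_range_reflect]
  refine Finset.sum_congr rfl fun j hj => ?_
  have hj : j ≤ K := by rw [Finset.mem_range] at hj; omega
  have e : K + 1 - 1 - j = K - j := by omega
  rw [e, map_smul, map_smul, LinearMap.smul_apply, dot_torus (pow_pos hr0 K), smul_eq_mul,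
    smul_eq_mul, ← shiftCoeff_symm hr0 (Nat.sub_le K j), Nat.sub_sub_self hj, mul_assoc]
  congr 5
  push_cast [hj]
  ring

/-! ### Growth of the matrix elements -/

/-- The finite set of Maya diagrams of energy `d`. -/
def shell (d : ℕ) : Finset Maya := (Maya.level d).filter fun T => T.energy = d

lemma mem_shell {d : ℕ} {T : Maya} : T ∈ shell d ↔ T.energy = d := by
  simp only [shell, Finset.mem_filter, Maya.mem_level]
  omega

/-- The commutation relation `G J_{-k} = J_{-k} G + k c_k G`. -/
lemma vertexOp_raising (c : ℕ+ → ℝ) (k : ℕ+) (v : Fock) :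
    vertexOp c (current ℝ (-(k : ℤ)) v) =
      current ℝ (-(k : ℤ)) (vertexOp c v) + weighted c k • vertexOp c v := by
  have hk : 0 < (k : ℕ) := k.pos
  have hcomm : ∀ (i : ℕ) (v : Fock),
      current ℝ ((i + 1 : ℕ) : ℤ) (current ℝ (-(k : ℤ)) v) =
        current ℝ (-(k : ℤ)) (current ℝ ((i + 1 : ℕ) : ℤ) v) +
          (if i + 1 = (k : ℕ) then (k : ℝ) else 0) • v := by
    intro i v
    rw [current_real, current_real]
    have h := current_bilinear_comm (l := ((i + 1 : ℕ) : ℤ)) (by positivity) (fun _ => 1)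
      (-(k : ℤ)) v
    have h0 : bilinear (fun n : ℤ => (fun _ : ℤ => (1 : ℝ)) n - (fun _ => 1) (n - ((i + 1 : ℕ) : ℤ)))
        (-(k : ℤ) + ((i + 1 : ℕ) : ℤ)) v = 0 := by
      rw [bilinear_apply]; simp
    rw [h0, zero_add, sub_eq_iff_eq_add] at h
    rw [h, add_comm]
    congr 2
    by_cases hik : i + 1 = (k : ℕ)
    · rw [if_pos (by omega), if_pos hik, hik]; simp
    · rw [if_neg (by omega), if_neg hik]
  have hlow : ∀ v, current ℝ (-(k : ℤ)) (lowering c v) =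
      lowering c (current ℝ (-(k : ℤ)) v) + (-(weighted c k) • (1 : Module.End ℝ Fock)) v := by
    intro v
    obtain ⟨N, hN⟩ := exists_mem_energyLE v
    obtain ⟨N', hN'⟩ := exists_mem_energyLE (current ℝ (-(k : ℤ)) v)
    set L := N + N' + k with hL
    rw [lowering_apply c (energyLE_mono (by omega : N ≤ L) hN),
      lowering_apply c (energyLE_mono (by omega : N' ≤ L) hN'), map_sum]
    simp only [hcomm, map_smul, smul_add, Finset.sum_add_distrib]
    rw [Finset.sum_eq_single_of_mem (s := Finset.range L) (k - 1 : ℕ)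
      (f := fun i => c i.succPNat • (if i + 1 = (k : ℕ) then (k : ℝ) else 0) • v)]
    · have : (k - 1 : ℕ).succPNat = k := PNat.eq (by rw [Nat.succPNat_coe]; omega)
      rw [if_pos (by omega), this, LinearMap.smul_apply, Module.End.one_apply, weighted]
      module
    · rw [Finset.mem_range]; omega
    · intro i _ hi
      rw [if_neg (by omega), zero_smul, smul_zero]
  have h := comm_locExp (B := -(weighted c k) • (1 : Module.End ℝ Fock))
    (locallyNilpotent_lowering c) (current ℝ (-(k : ℤ))) hlow (by simp) v
  rw [vertexOp, h, LinearMap.smul_apply, Module.End.one_apply, map_smul]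
  module

/-- The correlation `∑_{|T| = d} ⟨R|G|T⟩ ⟨u|G|T⟩`. -/
def shellSum (c : ℕ+ → ℝ) (R : Maya) (u : Fock) (d : ℕ) : ℝ :=
  ∑ T ∈ shell d, vertexOp c (single T 1) R * dot u (vertexOp c (single T 1))

/-- The transfer of `J_k` from one tensor factor to the other in `∑_T e_T ⊗ e_T`. -/
lemma sum_shell_current (B : Fock →ₗ[ℝ] Fock →ₗ[ℝ] ℝ) {k d : ℕ} (hk : k ≤ d) :
    ∑ T ∈ shell d, B (current ℝ k (single T 1)) (single T 1) =
      ∑ W ∈ shell (d - k), B (single W 1) (current ℝ (-(k : ℤ)) (single W 1)) := by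
  have hexp : ∀ (l : ℤ) (d d' : ℕ) (T : Maya), T ∈ shell d → (d : ℤ) = d' + l →
      current ℝ l (single T 1) =
        ∑ W ∈ shell d', current ℝ l (single T 1) W • single W (1 : ℝ) := by
    intro l d d' T hT hd
    conv_lhs => rw [← (current ℝ l (single T 1)).sum_single, Finsupp.sum]
    rw [Finset.sum_subset (s₂ := shell d')]
    · refine Finset.sum_congr rfl fun W _ => ?_
      rw [smul_single, smul_eq_mul, mul_one]
    · intro W hW
      rw [current_real] at hW
      have := energy_of_bilinear_ne_zero (mem_support_iff.1 hW)
      rw [mem_shell] at hT ⊢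
      omega
    · intro W _ hW
      rw [notMem_support_iff.1 hW, single_zero]
  have h1 : ∀ T ∈ shell d, B (current ℝ k (single T 1)) (single T 1) =
      ∑ W ∈ shell (d - k), current ℝ k (single T 1) W * B (single W 1) (single T 1) := by
    intro T hT
    rw [hexp k d (d - k) T hT (by omega), map_sum, LinearMap.sum_apply]
    refine Finset.sum_congr rfl fun W _ => ?_
    rw [map_smul, LinearMap.smul_apply, smul_eq_mul, ← hexp k d (d - k) T hT (by omega)]
  have h2 : ∀ W ∈ shell (d - k), B (single W 1) (current ℝ (-(k : ℤ)) (single W 1)) =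
      ∑ T ∈ shell d, current ℝ k (single T 1) W * B (single W 1) (single T 1) := by
    intro W hW
    rw [hexp (-k) (d - k) d W hW (by omega), map_sum]
    refine Finset.sum_congr rfl fun T _ => ?_
    rw [map_smul, smul_eq_mul, current_real, current_real,
      bilinear_transpose (fun _ => 1) (k : ℤ)]
  rw [Finset.sum_congr rfl h1, Finset.sum_congr rfl h2, Finset.sum_comm]

lemma shellSum_recursion (c : ℕ+ → ℝ) (R : Maya) (u : Fock) (d : ℕ) :
    ((d : ℝ) - R.energy) * shellSum c R u d =
      ∑ i ∈ Finset.range d, weighted c i.succPNat ^ 2 * shellSum c R u (d - (i + 1)) +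
      ∑ i ∈ Finset.range d, weighted c i.succPNat *
        shellSum c R (current ℝ ((i + 1 : ℕ) : ℤ) u) (d - (i + 1)) := by
  set B : Fock →ₗ[ℝ] Fock →ₗ[ℝ] ℝ :=
    ((LinearMap.mul ℝ ℝ).compl₂ (dot u ∘ₗ vertexOp c)) ∘ₗ (lapply R ∘ₗ vertexOp c) with hB
  have hBv : ∀ a b, B a b = vertexOp c a R * dot u (vertexOp c b) := fun a b => rfl
  have h1 : ∀ T ∈ shell d, ((d : ℝ) - R.energy) *
      (vertexOp c (single T 1) R * dot u (vertexOp c (single T 1))) =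
      ∑ i ∈ Finset.range d, weighted c i.succPNat *
        B (current ℝ ((i + 1 : ℕ) : ℤ) (single T 1)) (single T 1) := by
    intro T hT
    rw [mem_shell] at hT
    have h := DFunLike.congr_fun (energyOp_vertexOp c (single T 1)) R
    rw [energyOp_apply, Finsupp.sub_apply, energyOp, bilinear_zero_single, Maya.wt_id, map_smul,
      Finsupp.smul_apply, smul_eq_mul, hT,
      lowering_apply _ (single_mem_energyLE (le_of_eq hT) 1), map_sum,
      Finsupp.finsetSum_apply] at h
    have h' : ((d : ℝ) - R.energy) * vertexOp c (single T 1) R = ∑ i ∈ Finset.range d,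
        vertexOp c (weighted c i.succPNat • current ℝ ((i + 1 : ℕ) : ℤ) (single T 1)) R := by
      linarith
    rw [← mul_assoc, h', Finset.sum_mul]
    refine Finset.sum_congr rfl fun i _ => ?_
    rw [map_smul, Finsupp.smul_apply, smul_eq_mul, hBv, mul_assoc]
  rw [shellSum, Finset.mul_sum, Finset.sum_congr rfl h1, Finset.sum_comm,
    ← Finset.sum_add_distrib]
  refine Finset.sum_congr rfl fun i hi => ?_
  rw [← Finset.mul_sum, sum_shell_current B (by have := Finset.mem_range.1 hi; omega), sq,
    mul_assoc, ← mul_add]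
  congr 1
  rw [shellSum, shellSum, Finset.mul_sum, ← Finset.sum_add_distrib]
  refine Finset.sum_congr rfl fun W _ => ?_
  have h := vertexOp_raising c i.succPNat (single W 1)
  rw [Nat.succPNat_coe, Nat.succ_eq_add_one] at h
  rw [hBv, h, map_add, map_smul, smul_eq_mul, dot_current]
  ring

/-- A recursion `(d - e) a_d = ∑_k m_k a_{d - k} + b_d` with `m_k = O(x^k)` and `b_d = O(t^d)`,
`x < t`, forces `a_d = O(t^d)`: the factor `d - e` eventually beats the convolution. -/
lemma growth_of_recursion {a m b : ℕ → ℝ} {e M B x t : ℝ} (hx : 0 < x) (hxt : x < t) (hM : 0 ≤ M)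
    (hm : ∀ i, |m i| ≤ M * x ^ (i + 1)) (hb : ∀ d, |b d| ≤ B * t ^ d)
    (hrec : ∀ d : ℕ, ((d : ℝ) - e) * a d =
      ∑ i ∈ Finset.range d, m i * a (d - (i + 1)) + b d) :
    ∃ C, ∀ d, |a d| ≤ C * t ^ d := by
  have ht : 0 < t := hx.trans hxt
  set ρ := x / t with hρ
  have hρ0 : 0 ≤ ρ := by positivity
  have hρ1 : ρ < 1 := (div_lt_one ht).2 hxt
  have hB : 0 ≤ B := by simpa using (abs_nonneg _).trans (hb 0)
  set σ := M * (ρ / (1 - ρ)) with hσ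
  obtain ⟨D, hD⟩ := exists_nat_ge (e + σ + 1)
  set C := B + ∑ d ∈ Finset.range (D + 1), |a d| / t ^ d with hC
  have hterm : ∀ d, 0 ≤ |a d| / t ^ d := fun d => by positivity
  have hCB : B ≤ C := le_add_of_nonneg_right (Finset.sum_nonneg fun d _ => hterm d)
  have hC0 : 0 ≤ C := hB.trans hCB
  refine ⟨C, fun d => ?_⟩
  induction d using Nat.strong_induction_on with
  | _ d ih =>
    rcases le_or_gt d D with hd | hd
    · rw [← div_le_iff₀ (by positivity)]
      have := Finset.single_le_sum (f := fun d => |a d| / t ^ d) (fun d _ => hterm d)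
        (Finset.mem_range.2 (by omega : d < D + 1))
      linarith
    · have hDd : (D : ℝ) ≤ d := by exact_mod_cast hd.le
      have hσ0 : 0 ≤ σ := by
        have : 0 < 1 - ρ := by linarith
        positivity
      have hde : σ + 1 ≤ (d : ℝ) - e := by linarith
      have hpos : 0 < (d : ℝ) - e := by linarith
      have hsum : |∑ i ∈ Finset.range d, m i * a (d - (i + 1))| ≤ C * σ * t ^ d := by
        calc |∑ i ∈ Finset.range d, m i * a (d - (i + 1))|
            ≤ ∑ i ∈ Finset.range d, |m i * a (d - (i + 1))| := Finset.abs_sum_le_sum_abs _ _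
          _ ≤ ∑ i ∈ Finset.range d, (C * M * t ^ d * ρ) * ρ ^ i := by
              refine Finset.sum_le_sum fun i hi => ?_
              rw [Finset.mem_range] at hi
              rw [abs_mul]
              have h1 := mul_le_mul (hm i) (ih (d - (i + 1)) (by omega)) (abs_nonneg _)
                (by positivity)
              refine h1.trans (le_of_eq ?_)
              have e1 : t ^ d = t ^ (d - (i + 1)) * t ^ (i + 1) := by
                rw [← pow_add]; congr 1; omega
              have e2 : x ^ (i + 1) = ρ ^ (i + 1) * t ^ (i + 1) := by
                rw [← mul_pow, hρ, div_mul_cancel₀ _ ht.ne']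
              rw [e1, e2]; ring
          _ = (C * M * t ^ d * ρ) * ∑ i ∈ Finset.range d, ρ ^ i := by rw [Finset.mul_sum]
          _ ≤ (C * M * t ^ d * ρ) * (1 - ρ)⁻¹ := by
              refine mul_le_mul_of_nonneg_left ?_ (by positivity)
              rw [← tsum_geometric_of_lt_one hρ0 hρ1]
              exact (summable_geometric_of_lt_one hρ0 hρ1).sum_le_tsum _ fun i _ => by positivity
          _ = C * σ * t ^ d := by rw [hσ]; field_simp
      have h1 : ((d : ℝ) - e) * |a d| ≤ ((d : ℝ) - e) * (C * t ^ d) := by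
        calc ((d : ℝ) - e) * |a d| = |((d : ℝ) - e) * a d| := by
              rw [abs_mul, abs_of_pos hpos]
          _ ≤ C * σ * t ^ d + B * t ^ d := by
              rw [hrec]; exact (abs_add_le _ _).trans (add_le_add hsum (hb d))
          _ ≤ C * σ * t ^ d + C * t ^ d := by gcongr
          _ = (σ + 1) * (C * t ^ d) := by ring
          _ ≤ ((d : ℝ) - e) * (C * t ^ d) := by gcongr
      exact le_of_mul_le_mul_left h1 hpos

/-- The correlations grow at most like `t^d` for every `t > r²`. -/
lemma shellSum_growth {r t : ℝ} (hr0 : 0 < r) (hr1 : r < 1) (ht : r ^ 2 < t) (R : Maya) :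
    ∀ (N : ℕ) (u : Fock), u ∈ energyLE ℝ N → ∃ C, ∀ d, |shellSum (rootCoeff r) R u d| ≤ C * t ^ d := by
  intro N
  induction N using Nat.strong_induction_on with
  | _ N ih =>
    intro u hu
    have ht0 : 0 < t := (pow_pos hr0 2).trans ht
    set c := rootCoeff r with hc
    have hJ : ∀ i : ℕ, ∃ C, 0 ≤ C ∧ ∀ d,
        |shellSum c R (current ℝ ((i + 1 : ℕ) : ℤ) u) d| ≤ C * t ^ d := by
      intro i
      rcases le_or_gt (i + 1) N with hi | hi
      · obtain ⟨C, hC⟩ := ih (N - (i + 1)) (by omega) _ (current_mem hu)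
        exact ⟨C, by simpa using (abs_nonneg _).trans (hC 0), hC⟩
      · refine ⟨0, le_rfl, fun d => ?_⟩
        rw [current_eq_zero hu hi]
        simp [shellSum]
    choose C hC0 hC using hJ
    have hvan : ∀ i, N ≤ i → ∀ d, shellSum c R (current ℝ ((i + 1 : ℕ) : ℤ) u) d = 0 := by
      intro i hi d
      rw [current_eq_zero hu (by omega)]
      simp [shellSum]
    have hw : ∀ i : ℕ, weighted c i.succPNat = r ^ (i + 1) / (1 - r ^ (2 * (i + 1))) := by
      intro i
      rw [weighted, hc, rootCoeff, Nat.succPNat_coe, Nat.succ_eq_add_one]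
      have : ((i + 1 : ℕ) : ℝ) ≠ 0 := by positivity
      rw [mul_div_assoc', mul_div_mul_left _ _ this]
    have hr2 : 0 < 1 - r ^ 2 := by
      have := pow_lt_one₀ hr0.le hr1 (two_ne_zero); linarith
    refine growth_of_recursion (x := r ^ 2) (M := ((1 - r ^ 2)⁻¹) ^ 2)
      (B := ∑ i ∈ Finset.range N, |weighted c i.succPNat| * (C i * (t ^ (i + 1))⁻¹))
      (by positivity) ht (by positivity) (m := fun i => weighted c i.succPNat ^ 2)
      (b := fun d => ∑ i ∈ Finset.range d, weighted c i.succPNat *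
        shellSum c R (current ℝ ((i + 1 : ℕ) : ℤ) u) (d - (i + 1))) ?_ ?_
      (fun d => shellSum_recursion c R u d)
    · intro i
      have h1 : r ^ (2 * (i + 1)) ≤ r ^ 2 := pow_le_pow_of_le_one hr0.le hr1.le (by omega)
      rw [hw, abs_of_nonneg (by positivity), div_pow, div_eq_inv_mul, ← inv_pow]
      have e : (r ^ (i + 1)) ^ 2 = (r ^ 2) ^ (i + 1) := by ring
      rw [e]
      gcongr
      · have : 0 < 1 - r ^ (2 * (i + 1)) := by linarith
        positivity
    · intro d
      refine (Finset.abs_sum_le_sum_abs _ _).trans ?_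
      rw [Finset.sum_mul]
      calc ∑ i ∈ Finset.range d, |weighted c i.succPNat *
            shellSum c R (current ℝ ((i + 1 : ℕ) : ℤ) u) (d - (i + 1))|
          ≤ ∑ i ∈ Finset.range d, if i < N then
              |weighted c i.succPNat| * (C i * (t ^ (i + 1))⁻¹) * t ^ d else 0 := by
            refine Finset.sum_le_sum fun i hi => ?_
            rw [Finset.mem_range] at hi
            split_ifs with hN
            · rw [abs_mul, mul_assoc]
              refine mul_le_mul_of_nonneg_left ((hC i _).trans (le_of_eq ?_)) (abs_nonneg _)
              have e1 : t ^ d = t ^ (d - (i + 1)) * t ^ (i + 1) := by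
                rw [← pow_add]; congr 1; omega
              rw [e1]; field_simp
            · rw [hvan i (by omega), mul_zero, abs_zero]
        _ = ∑ i ∈ Finset.range d with i < N,
              |weighted c i.succPNat| * (C i * (t ^ (i + 1))⁻¹) * t ^ d := by
            rw [Finset.sum_filter]
        _ ≤ _ := by
            refine Finset.sum_le_sum_of_subset_of_nonneg (fun i hi => ?_) fun i _ _ => ?_
            · simp only [Finset.mem_filter, Finset.mem_range] at hi ⊢; exact hi.2
            · have := hC0 i; positivity

/-- A nonnegative function on Maya diagrams is summable if its sums over the energy shells are
dominated by a geometric series. -/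
lemma summable_of_shell_le {F : Maya → ℝ} (hF : ∀ T, 0 ≤ F T) {C τ : ℝ} (hτ0 : 0 ≤ τ) (hτ1 : τ < 1)
    (h : ∀ d, ∑ T ∈ shell d, F T ≤ C * τ ^ d) : Summable F := by
  have hC : 0 ≤ C := by
    simpa using (Finset.sum_nonneg fun T _ => hF T).trans (h 0)
  refine summable_of_sum_le (c := C * (1 - τ)⁻¹) hF fun s => ?_
  calc ∑ T ∈ s, F T = ∑ d ∈ Finset.range (s.sup Maya.energy + 1),
        ∑ T ∈ s with T.energy = d, F T := by
        refine (Finset.sum_fiberwise_of_maps_to (fun T hT => ?_) _).symm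
        rw [Finset.mem_range, Nat.lt_succ_iff]
        exact Finset.le_sup (f := Maya.energy) hT
    _ ≤ ∑ d ∈ Finset.range (s.sup Maya.energy + 1), C * τ ^ d := by
        refine Finset.sum_le_sum fun d _ => le_trans ?_ (h d)
        refine Finset.sum_le_sum_of_subset_of_nonneg (fun T hT => ?_) fun T _ _ => hF T
        rw [mem_shell]; exact (Finset.mem_filter.1 hT).2
    _ = C * ∑ d ∈ Finset.range (s.sup Maya.energy + 1), τ ^ d := by rw [Finset.mul_sum]
    _ ≤ C * (1 - τ)⁻¹ := by
        refine mul_le_mul_of_nonneg_left ?_ hC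
        rw [← tsum_geometric_of_lt_one hτ0 hτ1]
        exact (summable_geometric_of_lt_one hτ0 hτ1).sum_le_tsum _ fun i _ => by positivity

lemma summable_vertexOp_sq {r z : ℝ} (hr0 : 0 < r) (hr1 : r < 1) (hz : 0 < z) (hzr : z * r ^ 2 < 1)
    (R : Maya) :
    Summable fun T : Maya => (vertexOp (rootCoeff r) (single T 1) R) ^ 2 * z ^ T.energy := by
  obtain ⟨t, ht1, ht2⟩ := exists_between (show r ^ 2 < z⁻¹ by
    rw [← one_div, lt_div_iff₀ hz, mul_comm]; exact hzr)
  have ht0 : 0 < t := (pow_pos hr0 2).trans ht1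
  obtain ⟨C, hC⟩ := shellSum_growth hr0 hr1 ht1 R R.energy (single R 1)
    (single_mem_energyLE le_rfl 1)
  refine summable_of_shell_le (C := C) (τ := t * z) (fun T => by positivity) (by positivity)
    (by rw [← lt_div_iff₀ hz, one_div]; exact ht2) fun d => ?_
  have e : ∑ T ∈ shell d, (vertexOp (rootCoeff r) (single T 1) R) ^ 2 * z ^ T.energy =
      shellSum (rootCoeff r) R (single R 1) d * z ^ d := by
    rw [shellSum, Finset.sum_mul]
    refine Finset.sum_congr rfl fun T hT => ?_
    rw [mem_shell.1 hT, dot_single, sq]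
  rw [e, mul_pow, ← mul_assoc]
  exact mul_le_mul_of_nonneg_right ((le_abs_self _).trans (hC d)) (by positivity)

lemma summable_vertexOp_mul {r₁ r₂ Q : ℝ} (h₁ : 0 < r₁) (h₁' : r₁ < 1) (h₂ : 0 < r₂) (h₂' : r₂ < 1)
    (hQ : 0 < Q) (hconv : Q * (r₁ * r₂) < 1) (R R' : Maya) :
    Summable fun T : Maya => vertexOp (rootCoeff r₁) (single T 1) R *
      vertexOp (rootCoeff r₂) (single T 1) R' * Q ^ T.energy := by
  have s1 := summable_vertexOp_sq h₁ h₁' (z := Q * r₂ / r₁) (by positivity)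
    (by rw [sq]; field_simp; linarith) R
  have s2 := summable_vertexOp_sq h₂ h₂' (z := Q * r₁ / r₂) (by positivity)
    (by rw [sq]; field_simp; linarith) R'
  refine Summable.of_norm_bounded (s1.add s2) fun T => ?_
  set a := vertexOp (rootCoeff r₁) (single T 1) R
  set b := vertexOp (rootCoeff r₂) (single T 1) R'
  set n := T.energy
  -- the weights `(r₂/r₁)^n` and `(r₁/r₂)^n` in the two squares balance
  have hp : 0 < (r₂ / r₁) ^ n := by positivity
  have e1 : (Q * r₂ / r₁) ^ n = Q ^ n * (r₂ / r₁) ^ n := by rw [mul_div_assoc, mul_pow]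
  have e2 : (Q * r₁ / r₂) ^ n = Q ^ n * ((r₂ / r₁) ^ n)⁻¹ := by
    rw [mul_div_assoc, mul_pow, ← inv_pow, inv_div]
  rw [Real.norm_eq_abs, abs_mul, abs_mul, abs_of_pos (pow_pos hQ n), e1, e2]
  set p := (r₂ / r₁) ^ n
  have hQn : 0 < Q ^ n := pow_pos hQ n
  have key : |a| * |b| ≤ a ^ 2 * p + b ^ 2 * p⁻¹ := by
    have h : 0 ≤ (|a| * p - |b|) ^ 2 := sq_nonneg _
    have h' : |a| * |b| * p ≤ (a ^ 2 * p + b ^ 2 * p⁻¹) * p := by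
      have : (a ^ 2 * p + b ^ 2 * p⁻¹) * p = (|a| * p) ^ 2 + |b| ^ 2 := by
        rw [mul_pow, sq_abs, sq_abs]; field_simp
      rw [this]
      nlinarith [abs_nonneg a, abs_nonneg b, mul_nonneg (mul_nonneg (abs_nonneg a) (abs_nonneg b)) hp.le]
    exact le_of_mul_le_mul_right h' hp
  calc |a| * |b| * Q ^ n ≤ (a ^ 2 * p + b ^ 2 * p⁻¹) * Q ^ n :=
        mul_le_mul_of_nonneg_right key hQn.le
    _ = _ := by ring

/-! ### Diagonal operators -/

section Diagonal

open Classical in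
/-- `A` is the diagonal matrix with entries `d`. -/
def IsDiagonal (A : Matrix Maya Maya ℝ) (d : Maya → ℝ) : Prop :=
  ∀ S U, A S U = if S = U then d S else 0

lemma IsDiagonal.opMul_left {A : Matrix Maya Maya ℝ} {d : Maya → ℝ} (hA : IsDiagonal A d)
    (B : Matrix Maya Maya ℝ) (S U : Maya) : opMul A B S U = d S * B S U := by
  rw [opMul, tsum_eq_single S fun T hT => by rw [hA, if_neg hT.symm, zero_mul], hA, if_pos rfl]

lemma IsDiagonal.opMul_right {A : Matrix Maya Maya ℝ} {d : Maya → ℝ} (hA : IsDiagonal A d)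
    (B : Matrix Maya Maya ℝ) (S U : Maya) : opMul B A S U = B S U * d U := by
  rw [opMul, tsum_eq_single U fun T hT => by rw [hA, if_neg hT, mul_zero], hA, if_pos rfl]

lemma IsDiagonal.composable_left {A : Matrix Maya Maya ℝ} {d : Maya → ℝ} (hA : IsDiagonal A d)
    (B : Matrix Maya Maya ℝ) : Composable A B :=
  composable_of_row_finite fun S => (Set.finite_singleton S).subset fun T hT => by
    by_contra h
    exact hT ((hA S T).trans (if_neg fun h' => h h'.symm))

lemma IsDiagonal.composable_right {A : Matrix Maya Maya ℝ} {d : Maya → ℝ} (hA : IsDiagonal A d)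
    (B : Matrix Maya Maya ℝ) : Composable B A :=
  composable_of_col_finite fun U => (Set.finite_singleton U).subset fun T hT => by
    by_contra h
    exact hT ((hA T U).trans (if_neg h))

lemma IsDiagonal.opPow {A : Matrix Maya Maya ℝ} {d : Maya → ℝ} (hA : IsDiagonal A d) (n : ℕ) :
    IsDiagonal (opPow A n) fun S => d S ^ n := by
  classical
  induction n with
  | zero =>
    intro S U
    rw [_root_.opPow, Matrix.one_apply]
    simp
  | succ n ih =>
    intro S U
    rw [_root_.opPow, hA.opMul_left, ih]
    split_ifs <;> simp [pow_succ']

lemma hasSum_exp_smul (x : ℝ) : HasSum (fun n : ℕ => ((n.factorial : ℝ)⁻¹) • x ^ n) (Real.exp x) := by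
  have := NormedSpace.expSeries_div_hasSum_exp x
  rw [← Real.exp_eq_exp_ℝ] at this
  simpa only [div_eq_inv_mul, smul_eq_mul] using this

lemma IsDiagonal.exponentiable {A : Matrix Maya Maya ℝ} {d : Maya → ℝ} (hA : IsDiagonal A d) :
    Exponentiable A := by
  refine ⟨fun n => hA.composable_left _, fun S U => ?_⟩
  simp only [hA.opPow _ S U]
  split_ifs
  · exact (hasSum_exp_smul _).summable
  · simp

lemma IsDiagonal.opExp {A : Matrix Maya Maya ℝ} {d : Maya → ℝ} (hA : IsDiagonal A d) :
    IsDiagonal (opExp A) fun S => Real.exp (d S) := by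
  intro S U
  simp only [_root_.opExp, hA.opPow _ S U]
  split_ifs
  · exact (hasSum_exp_smul _).tsum_eq
  · simp

lemma isDiagonal_smul_bilinear (a : ℝ) (φ : ℤ → ℝ) :
    IsDiagonal (a • matEl (bilinear φ 0)) fun S => a * S.wt φ := by
  classical
  intro S U
  rw [Matrix.smul_apply, matEl, bilinear_zero_single, Finsupp.smul_apply, single_apply]
  by_cases h : S = U
  · simp [h]
  · simp [h, Ne.symm h]

end Diagonal

/-! ### The element `g` -/

/-- The eigenvalues of `x^{W_0/2}`. -/
def framing (x : ℝ) (S : Maya) : ℝ := Real.exp (1 / 2 * Real.log x * S.wt fun n => (n : ℝ) ^ 2)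

lemma isDiagonal_framing (x : ℝ) : IsDiagonal (opRpow x (1 / 2) W0) (framing x) :=
  (isDiagonal_smul_bilinear _ _).opExp

lemma isDiagonal_energy {Q : ℝ} (hQ : 0 < Q) :
    IsDiagonal (opRpow Q 1 L0) fun S => Q ^ S.energy := by
  have := (isDiagonal_smul_bilinear (1 * Real.log Q) fun n => (n : ℝ)).opExp
  intro S U
  refine (this S U).trans ?_
  split_ifs
  · simp only
    rw [Maya.wt_id, one_mul, mul_comm, Real.exp_nat_mul, Real.exp_log hQ]
  · rfl

/-- The matrix elements of `G_-(x) G_+(x)`, `x = r²`. -/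
def gram (r : ℝ) : Matrix Maya Maya ℝ := fun S T =>
  dot (vertexOp (rootCoeff r) (single S 1)) (vertexOp (rootCoeff r) (single T 1))

lemma gram_comm (r : ℝ) (S T : Maya) : gram r S T = gram r T S := dot_comm _ _

lemma gCoeff_eq {r : ℝ} (hr : 0 < r) : gCoeff (r ^ 2) = rootCoeff r := by
  funext k
  rw [gCoeff, rootCoeff, ← pow_mul]
  congr 1
  rw [← Real.rpow_natCast r 2, ← Real.rpow_mul hr.le, ← Real.rpow_natCast r k]
  congr 1
  push_cast; ring

lemma Gplus_eq {r : ℝ} (hr : 0 < r) : Gplus (r ^ 2) = entries (vertexOp (rootCoeff r)) := by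
  rw [Gplus, gCoeff_eq hr, opExp_currentSum]

lemma Gminus_eq {r : ℝ} (hr : 0 < r) :
    Gminus (r ^ 2) = (entries (vertexOp (rootCoeff r))).transpose := by
  rw [Gminus, gCoeff_eq hr, opExp_currentSum_neg]

lemma opMul_Gminus_Gplus {r : ℝ} (hr : 0 < r) : opMul (Gminus (r ^ 2)) (Gplus (r ^ 2)) = gram r := by
  ext S T
  rw [Gplus_eq hr, Gminus_eq hr, gram, dot_eq_sum _ _ subset_rfl, opMul, tsum_eq_sum]
  · rfl
  · intro R hR
    rw [Matrix.transpose_apply, entries, notMem_support_iff.1 hR, zero_mul]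

lemma composable_Gminus_Gplus {r : ℝ} (hr : 0 < r) : Composable (Gminus (r ^ 2)) (Gplus (r ^ 2)) := by
  rw [Gplus_eq hr]
  exact composable_of_col_finite (entries_col_finite _)

lemma gLeft_apply {r : ℝ} (hr : 0 < r) (S T : Maya) :
    gLeft (r ^ 2) S T = framing (r ^ 2) S * gram r S T := by
  rw [gLeft, opMul_Gminus_Gplus hr, (isDiagonal_framing _).opMul_left]

lemma gRight_apply {r : ℝ} (hr : 0 < r) (S T : Maya) :
    gRight (r ^ 2) S T = framing (r ^ 2) T * gram r T S := by
  rw [gRight, opMul_Gminus_Gplus hr, (isDiagonal_framing _).opMul_right]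
  rw [gram_comm, mul_comm]

/-- The convergence of the sum over intermediate states in `g`, which is where `Q √(q₁q₂) < 1`
enters. -/
lemma summable_gram {r₁ r₂ Q : ℝ} (h₁ : 0 < r₁) (h₁' : r₁ < 1) (h₂ : 0 < r₂) (h₂' : r₂ < 1)
    (hQ : 0 < Q) (hconv : Q * (r₁ * r₂) < 1) (S U : Maya) :
    Summable fun T : Maya => gram r₁ S T * Q ^ T.energy * gram r₂ U T := by
  have e : ∀ T : Maya, gram r₁ S T * Q ^ T.energy * gram r₂ U T =
      ∑ R ∈ (vertexOp (rootCoeff r₁) (single S 1)).support,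
        ∑ R' ∈ (vertexOp (rootCoeff r₂) (single U 1)).support,
          vertexOp (rootCoeff r₁) (single S 1) R * vertexOp (rootCoeff r₂) (single U 1) R' *
          (vertexOp (rootCoeff r₁) (single T 1) R * vertexOp (rootCoeff r₂) (single T 1) R' *
            Q ^ T.energy) := by
    intro T
    rw [gram, gram, dot_eq_sum _ _ subset_rfl, dot_eq_sum _ _ subset_rfl, Finset.sum_mul,
      Finset.sum_mul]
    refine Finset.sum_congr rfl fun R _ => ?_
    rw [Finset.mul_sum]
    exact Finset.sum_congr rfl fun R' _ => by ring
  simp only [e]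
  exact summable_sum fun R _ => summable_sum fun R' _ =>
    (summable_vertexOp_mul h₁ h₁' h₂ h₂' hQ hconv R R').mul_left _

/-- Framing turns the current `J_K = V^{(0)}_K` into `V^{(K)}_K`. -/
lemma J_mul_framing {r : ℝ} (hr : 0 < r) {K : ℕ} (hK : 0 < K) (S S' : Maya) :
    J K S S' * framing (r ^ 2) S' =
      framing (r ^ 2) S * torus (r ^ K) (-K) (single S 1) S' := by
  have hK0 : (K : ℤ) ≠ 0 := by omega
  rw [torus_transpose (pow_pos hr K), neg_neg, torus_apply, if_neg hK0, zero_smul, sub_zero,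
    Finsupp.smul_apply, smul_eq_mul, J, matEl, bilinear_single_apply, bilinear_single_apply]
  have hfin : ∀ c : ℤ → ℝ, (Function.support fun n : ℤ =>
      c n * normalOrd (K - n) n (single S' 1) S).Finite := fun c =>
    (finite_normalOrd K (single S' 1)).subset fun n hn h => hn (by simp [h])
  rw [finsum_mul' _ _ (hfin _), ← mul_assoc, mul_finsum' _ _ (hfin _)]
  refine finsum_congr fun n => ?_
  rw [normalOrd_eq]
  simp only [hK0, false_and, if_false, zero_smul, sub_zero]
  by_cases h : hop (n - K) n (single S' 1) S = 0
  · simp [h]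
  · have hw := wt_of_hop_ne_zero (fun n => (n : ℝ) ^ 2) h
    have : framing (r ^ 2) S' = framing (r ^ 2) S * (r ^ K) ^ (-(K : ℤ)) * (r ^ K) ^ (2 * n) := by
      have hpow : (r ^ K) ^ (-(K : ℤ)) * (r ^ K) ^ (2 * n) =
          Real.exp (Real.log r * (2 * n * K - K ^ 2)) := by
        rw [← zpow_add₀ (pow_pos hr K).ne', ← zpow_natCast r K, ← zpow_mul, ← Real.rpow_intCast,
          Real.rpow_def_of_pos hr]
        congr 2; push_cast; ring
      rw [mul_assoc, hpow, framing, framing, ← Real.exp_add, hw, Real.log_pow]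
      congr 1
      push_cast; ring
    rw [this]; ring

lemma torus_zero_single (s : ℝ) (T : Maya) : torus s 0 (single T 1) =
    (T.wt (fun n => (s ^ 2) ^ n) - s ^ 2 / (1 - s ^ 2)) • single T 1 := by
  have : (fun n : ℤ => s ^ (2 * n)) = fun n => (s ^ 2) ^ n := by
    funext n; rw [zpow_mul]; norm_cast
  rw [torus_apply, bilinear_zero_single, if_pos rfl, neg_zero, zpow_zero, one_smul, this, sub_smul]

lemma J_support {K : ℤ} {S T : Maya} (h : J K S T ≠ 0) : (T.energy : ℤ) = S.energy + K :=
  energy_of_bilinear_ne_zero h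

/-- The eigenvalue of `V^{(k)}_0 - q^k/(1 - q^k)` on `|T⟩`, where `y = q^k`. -/
def torusWeight (y : ℝ) (T : Maya) : ℝ := T.wt (fun n => y ^ n) - y / (1 - y)

/-- `J_K x^{W_0/2} G_- G_+ = (-1)^K x^{W_0/2} G_- G_+ (V^{(K)}_0 - x^K/(1 - x^K))`. -/
lemma sum_J_mul {r : ℝ} (hr : 0 < r) (hr1 : r < 1) {K : ℕ} (hK : 0 < K) (S T : Maya) :
    ∑ S' ∈ Maya.level (S.energy + K), J K S S' * (framing (r ^ 2) S' * gram r S' T) =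
      (-1) ^ K * (framing (r ^ 2) S * gram r S T * torusWeight ((r ^ K) ^ 2) T) := by
  have h := dot_vertexOp_torus hr hr1 hK (single S 1) (single T 1)
  rw [torus_zero_single, map_smul, map_smul, smul_eq_mul] at h
  have hsub : (torus (r ^ K) (-K) (single S 1)).support ⊆ Maya.level (S.energy + K) := by
    intro S' hS'
    have := energy_of_torus_ne_zero (mem_support_iff.1 hS')
    rw [Maya.mem_level]; omega
  have h2 : dot (vertexOp (rootCoeff r) (torus (r ^ K) (-K) (single S 1)))
      (vertexOp (rootCoeff r) (single T 1)) = ∑ S' ∈ Maya.level (S.energy + K),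
        torus (r ^ K) (-K) (single S 1) S' * gram r S' T := by
    conv_lhs => rw [← (torus (r ^ K) (-K) (single S 1)).sum_single]
    rw [Finsupp.sum_of_support_subset _ hsub _ (by simp), map_sum, map_sum, LinearMap.sum_apply]
    refine Finset.sum_congr rfl fun S' _ => ?_
    have e : single S' (torus (r ^ K) (-K) (single S 1) S') =
        torus (r ^ K) (-K) (single S 1) S' • single S' (1 : ℝ) := by
      rw [smul_single, smul_eq_mul, mul_one]
    rw [e, map_smul, map_smul, LinearMap.smul_apply, smul_eq_mul, gram]
  rw [h2] at h
  have h3 : ∀ S' ∈ Maya.level (S.energy + K), J K S S' * (framing (r ^ 2) S' * gram r S' T) =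
      framing (r ^ 2) S * (torus (r ^ K) (-K) (single S 1) S' * gram r S' T) := by
    intro S' _
    rw [← mul_assoc, J_mul_framing hr hK, mul_assoc]
  rw [Finset.sum_congr rfl h3, ← Finset.mul_sum, h, torusWeight, gram]
  ring

section Element

variable {r₁ r₂ Q : ℝ}

lemma opMul_gLeft_energy (h₁ : 0 < r₁) (hQ : 0 < Q) (S T : Maya) :
    opMul (gLeft (r₁ ^ 2)) (opRpow Q 1 L0) S T =
      framing (r₁ ^ 2) S * gram r₁ S T * Q ^ T.energy := by
  rw [(isDiagonal_energy hQ).opMul_right, gLeft_apply h₁]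

lemma gElement_apply (h₁ : 0 < r₁) (h₂ : 0 < r₂) (hQ : 0 < Q) (S U : Maya) :
    gElement (r₁ ^ 2) (r₂ ^ 2) Q S U =
      ∑' T : Maya, framing (r₁ ^ 2) S * gram r₁ S T * Q ^ T.energy *
        (framing (r₂ ^ 2) U * gram r₂ U T) := by
  rw [gElement, opMul]
  simp only [opMul_gLeft_energy h₁ hQ, gRight_apply h₂]

lemma summable_gElement (h₁ : 0 < r₁) (h₁' : r₁ < 1) (h₂ : 0 < r₂) (h₂' : r₂ < 1)
    (hQ : 0 < Q) (hconv : Q * (r₁ * r₂) < 1) (S U : Maya) :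
    Summable fun T : Maya => framing (r₁ ^ 2) S * gram r₁ S T * Q ^ T.energy *
        (framing (r₂ ^ 2) U * gram r₂ U T) := by
  have := (summable_gram h₁ h₁' h₂ h₂' hQ hconv S U).mul_left
    (framing (r₁ ^ 2) S * framing (r₂ ^ 2) U)
  refine this.congr fun T => ?_
  ring

lemma gElementConverges (h₁ : 0 < r₁) (h₁' : r₁ < 1) (h₂ : 0 < r₂) (h₂' : r₂ < 1)
    (hQ : 0 < Q) (hconv : Q * (r₁ * r₂) < 1) : GElementConverges (r₁ ^ 2) (r₂ ^ 2) Q := by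
  refine ⟨?_, ?_, (isDiagonal_smul_bilinear _ _).exponentiable, ?_,
    (isDiagonal_framing _).composable_left _, (isDiagonal_framing _).composable_right _,
    (isDiagonal_energy hQ).composable_right _, ?_⟩
  · intro x _ ε hε
    rcases hε with rfl | rfl
    · exact ⟨currentSummable_one _, exponentiable_currentSum _⟩
    · exact ⟨currentSummable_neg_one _, exponentiable_currentSum_neg _⟩
  · exact fun x _ => (isDiagonal_smul_bilinear _ _).exponentiable
  · rintro x (rfl | rfl)
    · exact composable_Gminus_Gplus h₁
    · exact composable_Gminus_Gplus h₂
  · intro S U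
    simp only [opMul_gLeft_energy h₁ hQ, gRight_apply h₂]
    exact summable_gElement h₁ h₁' h₂ h₂' hQ hconv S U

lemma composable_J_left (K : ℕ) (B : Matrix Maya Maya ℝ) : Composable (J K) B :=
  composable_of_row_finite fun S =>
    (Maya.finite_energy_le (S.energy + K)).subset fun T hT => by
      have := J_support hT
      simp only [Set.mem_ofPred_eq]; omega

lemma composable_J_right (K : ℕ) (B : Matrix Maya Maya ℝ) : Composable B (J (-K)) :=
  composable_of_col_finite fun U =>
    (Maya.finite_energy_le (U.energy + K)).subset fun T hT => by
      have := J_support hT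
      simp only [Set.mem_ofPred_eq]; omega

lemma opMul_J_left_apply (K : ℕ) (B : Matrix Maya Maya ℝ) (S U : Maya) :
    opMul (J K) B S U = ∑ S' ∈ Maya.level (S.energy + K), J K S S' * B S' U := by
  rw [opMul, tsum_eq_sum]
  intro T hT
  have : J K S T = 0 := by
    by_contra h
    have := J_support h
    rw [Maya.mem_level] at hT; omega
  rw [this, zero_mul]

lemma opMul_J_right_apply (K : ℕ) (B : Matrix Maya Maya ℝ) (S U : Maya) :
    opMul B (J (-K)) S U = ∑ U' ∈ Maya.level (U.energy + K), J K U U' * B S U' := by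
  rw [opMul, tsum_eq_sum]
  · refine Finset.sum_congr rfl fun U' _ => ?_
    rw [J_transpose, mul_comm]
  intro T hT
  have : J (-K) T U = 0 := by
    by_contra h
    have := J_support h
    rw [Maya.mem_level] at hT; omega
  rw [this, mul_zero]

/-- The intertwining relation. Both sides are equal to
`q₁^{W_0/2} G_- G_+ (V_0 - const) Q^{L_0} G_- G_+ q₂^{W_0/2}` with the same diagonal operator in the
middle. -/
theorem J_gElement (h₁ : 0 < r₁) (h₁' : r₁ < 1) (h₂ : 0 < r₂) (h₂' : r₂ < 1)
    (hQ : 0 < Q) (hconv : Q * (r₁ * r₂) < 1) {K₁ K₂ : ℕ} (hK₁ : 0 < K₁) (hK₂ : 0 < K₂)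
    (hK : (r₁ ^ K₁) ^ 2 = (r₂ ^ K₂) ^ 2) :
    (-1 : ℝ) ^ K₁ • opMul (J K₁) (gElement (r₁ ^ 2) (r₂ ^ 2) Q) =
      (-1 : ℝ) ^ K₂ • opMul (gElement (r₁ ^ 2) (r₂ ^ 2) Q) (J (-K₂)) := by
  have hs := summable_gElement h₁ h₁' h₂ h₂' hQ hconv
  ext S U
  rw [Matrix.smul_apply, Matrix.smul_apply, opMul_J_left_apply, opMul_J_right_apply]
  simp only [gElement_apply h₁ h₂ hQ, smul_eq_mul, ← tsum_mul_left]
  rw [← Summable.tsum_finsetSum fun S' _ => (hs S' U).mul_left _,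
    ← Summable.tsum_finsetSum fun U' _ => (hs S U').mul_left _, ← tsum_mul_left, ← tsum_mul_left]
  refine tsum_congr fun T => ?_
  have e1 : ∀ S' ∈ Maya.level (S.energy + K₁), J K₁ S S' *
      (framing (r₁ ^ 2) S' * gram r₁ S' T * Q ^ T.energy * (framing (r₂ ^ 2) U * gram r₂ U T)) =
      J K₁ S S' * (framing (r₁ ^ 2) S' * gram r₁ S' T) *
        (Q ^ T.energy * (framing (r₂ ^ 2) U * gram r₂ U T)) := fun S' _ => by ring
  have e2 : ∀ U' ∈ Maya.level (U.energy + K₂), J K₂ U U' *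
      (framing (r₁ ^ 2) S * gram r₁ S T * Q ^ T.energy * (framing (r₂ ^ 2) U' * gram r₂ U' T)) =
      J K₂ U U' * (framing (r₂ ^ 2) U' * gram r₂ U' T) *
        (framing (r₁ ^ 2) S * gram r₁ S T * Q ^ T.energy) := fun U' _ => by ring
  rw [Finset.sum_congr rfl e1, Finset.sum_congr rfl e2, ← Finset.sum_mul, ← Finset.sum_mul,
    sum_J_mul h₁ h₁' hK₁, sum_J_mul h₂ h₂' hK₂, hK]
  have h1 : (-1 : ℝ) ^ K₁ * (-1) ^ K₁ = 1 := by rw [← mul_pow]; simp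
  have h2 : (-1 : ℝ) ^ K₂ * (-1) ^ K₂ = 1 := by rw [← mul_pow]; simp
  linear_combination (framing (r₁ ^ 2) S * gram r₁ S T * torusWeight ((r₂ ^ K₂) ^ 2) T *
    (Q ^ T.energy * (framing (r₂ ^ 2) U * gram r₂ U T))) * (h1 - h2)

end Element

/-! ### Power series in the Toda times -/

open scoped MvPowerSeries.WithPiTopology

open MvPowerSeries in
lemma coeff_algebraMap_mul (r : ℝ) (f : TimeRing) (α : (ℕ+ ⊕ ℕ+) →₀ ℕ) :
    coeff α (algebraMap ℝ TimeRing r * f) = r * coeff α f := by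
  rw [← Algebra.smul_def]; rfl

lemma pderiv_algebraMap_mul (i : ℕ+ ⊕ ℕ+) (r : ℝ) (f : TimeRing) :
    MvPowerSeries.pderiv ℝ i (algebraMap ℝ TimeRing r * f) =
      algebraMap ℝ TimeRing r * MvPowerSeries.pderiv ℝ i f := by
  rw [← Algebra.smul_def, ← Algebra.smul_def]
  exact Derivation.map_smul _ r f

lemma summable_of_coeff_finite {ι : Type*} {f : ι → TimeRing}
    (h : ∀ α, {i | MvPowerSeries.coeff α (f i) ≠ 0}.Finite) : Summable f :=
  MvPowerSeries.WithPiTopology.summable_iff_summable_coeff.2 fun α =>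
    summable_of_hasFiniteSupport (h α)

lemma hasSum_pderiv {ι : Type*} {f : ι → TimeRing} {s : TimeRing} (h : HasSum f s) (i : ℕ+ ⊕ ℕ+) :
    HasSum (fun j => MvPowerSeries.pderiv ℝ i (f j)) (MvPowerSeries.pderiv ℝ i s) := by
  rw [MvPowerSeries.WithPiTopology.hasSum_iff_hasSum_coeff] at h ⊢
  intro d
  simp only [MvPowerSeries.coeff_pderiv]
  exact (h _).mul_right _

/-- The weight of a monomial in the times, where `T_k` and `T̄_k` have weight `k`. -/
def timeWeight : ((ℕ+ ⊕ ℕ+) →₀ ℕ) →+ ℕ :=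
  weight (Sum.elim (fun k : ℕ+ => (k : ℕ)) fun k : ℕ+ => (k : ℕ))

/-- The coefficient of every monomial `α` in `f S` vanishes for states `S` of energy larger than
`N` plus the weight of `α`. -/
def TimeBounded (N : ℕ) (f : Maya → TimeRing) : Prop :=
  ∀ S α, MvPowerSeries.coeff α (f S) ≠ 0 → S.energy ≤ N + timeWeight α

/-- If the coefficient of a monomial in a product is nonzero then so are coefficients of two
complementary monomials in the factors. -/
lemma exists_coeff_of_mul {f g : TimeRing} {α : (ℕ+ ⊕ ℕ+) →₀ ℕ}
    (h : MvPowerSeries.coeff α (f * g) ≠ 0) :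
    ∃ β γ, timeWeight β + timeWeight γ = timeWeight α ∧ MvPowerSeries.coeff β f ≠ 0 ∧
      MvPowerSeries.coeff γ g ≠ 0 := by
  classical
  rw [MvPowerSeries.coeff_mul] at h
  obtain ⟨⟨β, γ⟩, hm, hne⟩ := Finset.exists_ne_zero_of_sum_ne_zero h
  refine ⟨β, γ, ?_, left_ne_zero_of_mul hne, right_ne_zero_of_mul hne⟩
  rw [← map_add, Finset.HasAntidiagonal.mem_antidiagonal.1 hm]

/-- The vectors whose coefficients at a monomial `α` have energy at least `N` minus the weight of
`α`. -/
def weightGE (N : ℕ) : Submodule ℝ (Maya →₀ TimeRing) where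
  carrier := {v | ∀ S α, MvPowerSeries.coeff α (v S) ≠ 0 → N ≤ S.energy + timeWeight α}
  zero_mem' := by intro S α h; simp at h
  add_mem' := by
    intro v w hv hw S α h
    rw [Finsupp.add_apply, map_add] at h
    by_cases h' : MvPowerSeries.coeff α (v S) = 0
    · exact hw S α (by simpa [h'] using h)
    · exact hv S α h'
  smul_mem' := by
    intro r v hv S α h
    exact hv S α fun h' => h (by rw [Finsupp.smul_apply, MvPowerSeries.coeff_smul, h', mul_zero])

lemma mem_weightGE {N : ℕ} {v : Maya →₀ TimeRing} : v ∈ weightGE N ↔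
    ∀ S α, MvPowerSeries.coeff α (v S) ≠ 0 → N ≤ S.energy + timeWeight α := Iff.rfl

section Times

variable {c : ℕ+ → TimeRing}

lemma lowering_mem_weightGE (hc : ∀ k α, MvPowerSeries.coeff α (c k) ≠ 0 → (k : ℕ) ≤ timeWeight α)
    {N : ℕ} {v : Maya →₀ TimeRing} (hv : v ∈ weightGE N) : lowering c v ∈ weightGE N := by
  obtain ⟨M, hM⟩ := exists_mem_energyLE v
  rw [lowering_apply c hM]
  refine Submodule.sum_mem _ fun i _ => ?_
  rw [mem_weightGE]
  intro S α h
  rw [Finsupp.smul_apply, smul_eq_mul] at h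
  obtain ⟨β, γ, hβγ, hβ, hγ⟩ := exists_coeff_of_mul h
  have h1 := hc _ β hβ
  rw [Nat.succPNat_coe] at h1
  rw [apply_eq_sum, map_sum] at hγ
  obtain ⟨U, _, hU⟩ := Finset.exists_ne_zero_of_sum_ne_zero hγ
  rw [show current TimeRing ((i + 1 : ℕ) : ℤ) (single U 1) S = _ from entries_extend _ _ _,
    coeff_algebraMap_mul] at hU
  have h2 := energy_of_bilinear_ne_zero (left_ne_zero_of_mul hU)
  have h3 := hv U γ (right_ne_zero_of_mul hU)
  omega

lemma vertexOp_mem_weightGE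
    (hc : ∀ k α, MvPowerSeries.coeff α (c k) ≠ 0 → (k : ℕ) ≤ timeWeight α)
    {N : ℕ} {v : Maya →₀ TimeRing} (hv : v ∈ weightGE N) : vertexOp c v ∈ weightGE N := by
  obtain ⟨M, hM⟩ := locallyNilpotent_lowering c v
  rw [vertexOp, locExp_apply _ _ hM]
  refine Submodule.sum_mem _ fun n hn => Submodule.smul_mem _ _ ?_
  clear hn hM
  induction n with
  | zero => simpa using hv
  | succ n ih =>
    rw [pow_succ', Module.End.mul_apply]
    exact lowering_mem_weightGE hc ih

/-- The matrix elements `⟨P| exp (∑ c_k J_k) |S⟩`, as a function of `S`, contain only monomials whose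
weight is at least the energy of `S` relative to `P`. -/
lemma timeBounded_vertexOp
    (hc : ∀ k α, MvPowerSeries.coeff α (c k) ≠ 0 → (k : ℕ) ≤ timeWeight α) (P : Maya) :
    TimeBounded P.energy fun S => entries (vertexOp c) P S := by
  classical
  intro S α h
  have hS : single S (1 : TimeRing) ∈ weightGE S.energy := by
    rw [mem_weightGE]
    intro U β hU
    rw [single_apply] at hU
    split_ifs at hU with hSU
    · rw [hSU]; omega
    · simp at hU
  exact vertexOp_mem_weightGE hc hS P α h

/-- Differentiation of the coefficients with respect to a time. -/
def timeDeriv (i : ℕ+ ⊕ ℕ+) : (Maya →₀ TimeRing) →ₗ[ℝ] (Maya →₀ TimeRing) :=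
  mapRange.linearMap (MvPowerSeries.pderiv ℝ i : TimeRing →ₗ[ℝ] TimeRing)

lemma timeDeriv_apply (i : ℕ+ ⊕ ℕ+) (v : Maya →₀ TimeRing) (S : Maya) :
    timeDeriv i v S = MvPowerSeries.pderiv ℝ i (v S) := rfl

lemma timeDeriv_mem {i : ℕ+ ⊕ ℕ+} {N : ℕ} {v : Maya →₀ TimeRing} (hv : v ∈ energyLE TimeRing N) :
    timeDeriv i v ∈ energyLE TimeRing N := by
  rw [energyLE, mem_supported] at hv ⊢
  refine fun S hS => hv (mem_support_iff.2 fun h => mem_support_iff.1 hS ?_)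
  rw [timeDeriv_apply, h, map_zero]

lemma timeDeriv_smul (i : ℕ+ ⊕ ℕ+) (f : TimeRing) (v : Maya →₀ TimeRing) :
    timeDeriv i (f • v) = f • timeDeriv i v + MvPowerSeries.pderiv ℝ i f • v := by
  ext1 S
  simp only [timeDeriv_apply, Finsupp.smul_apply, Finsupp.add_apply, smul_eq_mul,
    Derivation.leibniz]
  ring

lemma timeDeriv_current (i : ℕ+ ⊕ ℕ+) (k : ℤ) (v : Maya →₀ TimeRing) :
    timeDeriv i (current TimeRing k v) = current TimeRing k (timeDeriv i v) := by
  ext1 S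
  have hsub : (timeDeriv i v).support ⊆ v.support := fun U hU =>
    mem_support_iff.2 fun h => mem_support_iff.1 hU (by rw [timeDeriv_apply, h, map_zero])
  rw [timeDeriv_apply, apply_eq_sum (current TimeRing k) v,
    apply_eq_sum_of_subset (current TimeRing k) _ S hsub, map_sum]
  refine Finset.sum_congr rfl fun U _ => ?_
  rw [show current TimeRing k (single U 1) S = _ from entries_extend _ _ _, timeDeriv_apply,
    pderiv_algebraMap_mul]

/-- The derivative of `exp (∑ c_k J_k)` when `c_k` depends on the time `i` only for `k = K`, linearly
with slope `a`. -/
lemma pderiv_vertexOp {i : ℕ+ ⊕ ℕ+} {K : ℕ+} {a : ℝ}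
    (hc : ∀ k, MvPowerSeries.pderiv ℝ i (c k) = if k = K then algebraMap ℝ TimeRing a else 0)
    (P S : Maya) :
    MvPowerSeries.pderiv ℝ i (entries (vertexOp c) P S) = algebraMap ℝ TimeRing a *
      ∑' W, entries (vertexOp c) P W * algebraMap ℝ TimeRing (J K W S) := by
  classical
  have hD : ∀ v, timeDeriv i (lowering c v) = lowering c (timeDeriv i v) +
      (algebraMap ℝ TimeRing a • current TimeRing K) v := by
    intro v
    obtain ⟨N, hN⟩ := exists_mem_energyLE v
    have hN' := energyLE_mono (Nat.le_add_right N K) hN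
    rw [lowering_apply c hN', lowering_apply c (timeDeriv_mem hN'), map_sum]
    simp only [timeDeriv_smul, timeDeriv_current, Finset.sum_add_distrib, hc]
    congr 1
    have hpos := K.pos
    rw [Finset.sum_eq_single_of_mem ((K : ℕ) - 1) (Finset.mem_range.2 (by omega))]
    · have : ((K : ℕ) - 1).succPNat = K := PNat.eq (by rw [Nat.succPNat_coe]; omega)
      rw [this, if_pos rfl, LinearMap.smul_apply]
      congr 4
      omega
    · intro j _ hj
      rw [if_neg, zero_smul]
      rintro rfl
      exact hj (by rw [Nat.succPNat_coe]; rfl)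
  have hcomm : lowering c * (algebraMap ℝ TimeRing a • current TimeRing K) =
      (algebraMap ℝ TimeRing a • current TimeRing K) * lowering c := by
    rw [mul_smul_comm, smul_mul_assoc, lowering_comm_current c K.pos]
  have h := DFunLike.congr_fun (comm_locExp (locallyNilpotent_lowering c) (timeDeriv i) hD hcomm
    (single S 1)) P
  have h0 : timeDeriv i (single S (1 : TimeRing)) = 0 := by
    ext1 U
    rw [timeDeriv_apply, single_apply]
    split_ifs <;> simp
  rw [h0, map_zero, zero_add, timeDeriv_apply, LinearMap.smul_apply, map_smul, Finsupp.smul_apply,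
    smul_eq_mul] at h
  refine h.trans (congrArg _ ?_)
  rw [tsum_eq_sum (s := (current TimeRing K (single S 1)).support)]
  · refine (apply_eq_sum _ _ P).trans (Finset.sum_congr rfl fun W _ => ?_)
    congr 1
    exact entries_extend _ _ _
  · intro W hW
    have : algebraMap ℝ TimeRing (J K W S) = current TimeRing K (single S 1) W :=
      (entries_extend _ _ _).symm
    rw [this, notMem_support_iff.1 hW, mul_zero]

end Times

/-! ### Matrix elements with power series coefficients -/

/-- The matrix element `∑_{S,U} a_S A_{SU} b_U`. -/
def sandwich (a b : Maya → TimeRing) (A : Matrix Maya Maya ℝ) : TimeRing :=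
  ∑' x : Maya × Maya, a x.1 * (algebraMap ℝ TimeRing (A x.1 x.2) * b x.2)

variable {a b : Maya → TimeRing} {N M : ℕ}

lemma summable_sandwich (ha : TimeBounded N a) (hb : TimeBounded M b) (A : Matrix Maya Maya ℝ) :
    Summable fun x : Maya × Maya => a x.1 * (algebraMap ℝ TimeRing (A x.1 x.2) * b x.2) := by
  refine summable_of_coeff_finite fun α => ?_
  refine ((Maya.finite_energy_le (N + timeWeight α)).prod
    (Maya.finite_energy_le (M + timeWeight α))).subset fun x hx => ?_
  obtain ⟨β, γ, h, hβ, hγ⟩ := exists_coeff_of_mul hx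
  rw [coeff_algebraMap_mul] at hγ
  have h1 := ha _ _ hβ
  have h2 := hb _ _ (right_ne_zero_of_mul hγ)
  simp only [Set.mem_prod, Set.mem_ofPred_eq]
  omega

lemma summable_right (hb : TimeBounded M b) (A : Matrix Maya Maya ℝ) (S : Maya) :
    Summable fun U => algebraMap ℝ TimeRing (A S U) * b U := by
  refine summable_of_coeff_finite fun α =>
    (Maya.finite_energy_le (M + timeWeight α)).subset fun U hU => ?_
  simp only [Set.mem_ofPred_eq, coeff_algebraMap_mul] at hU
  exact hb _ _ (right_ne_zero_of_mul hU)

lemma summable_left (ha : TimeBounded N a) (f : Maya → TimeRing) :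
    Summable fun S => a S * f S := by
  refine summable_of_coeff_finite fun α =>
    (Maya.finite_energy_le (N + timeWeight α)).subset fun S hS => ?_
  obtain ⟨β, γ, h, hβ, -⟩ := exists_coeff_of_mul hS
  exact (ha _ _ hβ).trans (by omega)

lemma sandwich_eq_iterated (ha : TimeBounded N a) (hb : TimeBounded M b) (A : Matrix Maya Maya ℝ) :
    ∑' S, a S * ∑' U, algebraMap ℝ TimeRing (A S U) * b U = sandwich a b A := by
  rw [sandwich, (summable_sandwich ha hb A).tsum_prod]
  exact tsum_congr fun S => ((summable_right hb A S).tsum_mul_left _).symm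

lemma sandwich_transpose (A : Matrix Maya Maya ℝ) : sandwich a b A.transpose = sandwich b a A := by
  rw [sandwich, sandwich, ← (Equiv.prodComm Maya Maya).tsum_eq]
  refine tsum_congr fun x => ?_
  simp only [Equiv.prodComm_apply, Prod.fst_swap, Prod.snd_swap, Matrix.transpose_apply]
  ring

lemma sandwich_smul (r : ℝ) (A : Matrix Maya Maya ℝ) (ha : TimeBounded N a) (hb : TimeBounded M b) :
    sandwich a b (r • A) = r • sandwich a b A := by
  rw [sandwich, sandwich, Algebra.smul_def, ← (summable_sandwich ha hb A).tsum_mul_left]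
  refine tsum_congr fun x => ?_
  rw [Matrix.smul_apply, smul_eq_mul, map_mul]
  ring

/-- A current acting on the left vector may be moved into the operator. -/
lemma sandwich_current (ha : TimeBounded N a) (hb : TimeBounded M b) (A : Matrix Maya Maya ℝ)
    (K : ℕ) :
    ∑' x : Maya × Maya, (∑' W, a W * algebraMap ℝ TimeRing (J K W x.1)) *
      (algebraMap ℝ TimeRing (A x.1 x.2) * b x.2) = sandwich a b (opMul (J K) A) := by
  set X : Maya → Maya → Maya → TimeRing := fun W S U =>
    a W * (algebraMap ℝ TimeRing (J K W S) * (algebraMap ℝ TimeRing (A S U) * b U)) with hX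
  have hXne : ∀ W S U α, MvPowerSeries.coeff α (X W S U) ≠ 0 → W.energy ≤ N + timeWeight α ∧
      S.energy ≤ N + timeWeight α + K ∧ U.energy ≤ M + timeWeight α := by
    intro W S U α h
    obtain ⟨β, γ, hw, hβ, hγ⟩ := exists_coeff_of_mul h
    rw [coeff_algebraMap_mul, coeff_algebraMap_mul] at hγ
    have h1 := ha _ _ hβ
    have h2 := hb _ _ (right_ne_zero_of_mul (right_ne_zero_of_mul hγ))
    have h3 := J_support (left_ne_zero_of_mul hγ)
    omega
  have hfin : ∀ α, ((Maya.finite_energy_le (N + timeWeight α)).toFinset ×ˢ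
      (Maya.finite_energy_le (N + timeWeight α + K)).toFinset ×ˢ
      (Maya.finite_energy_le (M + timeWeight α)).toFinset : Set (Maya × Maya × Maya)).Finite :=
    fun α => (Finset.finite_toSet _).prod ((Finset.finite_toSet _).prod (Finset.finite_toSet _))
  have s1 : Summable fun y : (Maya × Maya) × Maya => X y.2 y.1.1 y.1.2 := by
    refine summable_of_coeff_finite fun α => ?_
    refine ((hfin α).preimage (f := fun y : (Maya × Maya) × Maya => (y.2, y.1.1, y.1.2)) ?_).subset
      fun y hy => ?_
    · rintro ⟨⟨_, _⟩, _⟩ _ ⟨⟨_, _⟩, _⟩ _ h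
      simp only [Prod.mk.injEq] at h ⊢
      tauto
    · simpa using hXne _ _ _ α hy
  have s2 : Summable fun y : (Maya × Maya) × Maya => X y.1.1 y.2 y.1.2 := by
    refine summable_of_coeff_finite fun α => ?_
    refine ((hfin α).preimage (f := fun y : (Maya × Maya) × Maya => (y.1.1, y.2, y.1.2)) ?_).subset
      fun y hy => ?_
    · rintro ⟨⟨_, _⟩, _⟩ _ ⟨⟨_, _⟩, _⟩ _ h
      simp only [Prod.mk.injEq] at h ⊢
      tauto
    · simpa using hXne _ _ _ α hy
  have e1 : ∀ x : Maya × Maya, (∑' W, a W * algebraMap ℝ TimeRing (J K W x.1)) *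
      (algebraMap ℝ TimeRing (A x.1 x.2) * b x.2) = ∑' W, X W x.1 x.2 := by
    intro x
    rw [← (summable_left ha _).tsum_mul_right]
    exact tsum_congr fun W => by rw [hX]; ring
  have e2 : ∀ x : Maya × Maya, a x.1 * (algebraMap ℝ TimeRing (opMul (J K) A x.1 x.2) * b x.2) =
      ∑' S, X x.1 S x.2 := by
    intro x
    rw [opMul_J_left_apply, tsum_eq_sum (s := Maya.level (x.1.energy + K)), map_sum,
      Finset.sum_mul, Finset.mul_sum]
    · exact Finset.sum_congr rfl fun S _ => by rw [hX, map_mul]; ring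
    · intro S hS
      have : J K x.1 S = 0 := by
        by_contra h
        have := J_support h
        rw [Maya.mem_level] at hS; omega
      rw [hX]
      simp [this]
  rw [sandwich, tsum_congr e1, tsum_congr e2, ← s1.tsum_prod, ← s2.tsum_prod]
  let σ : (Maya × Maya) × Maya ≃ (Maya × Maya) × Maya :=
    { toFun := fun y => ((y.2, y.1.2), y.1.1)
      invFun := fun y => ((y.2, y.1.2), y.1.1)
      left_inv := fun _ => rfl
      right_inv := fun _ => rfl }
  exact (σ.tsum_eq fun y : (Maya × Maya) × Maya => X y.1.1 y.2 y.1.2)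

/-! ### The tau function -/

lemma coeff_X_weight {i : ℕ+ ⊕ ℕ+} {α : (ℕ+ ⊕ ℕ+) →₀ ℕ}
    (h : MvPowerSeries.coeff α (MvPowerSeries.X i : TimeRing) ≠ 0) :
    timeWeight α = Sum.elim (fun k : ℕ+ => (k : ℕ)) (fun k : ℕ+ => (k : ℕ)) i := by
  classical
  rw [MvPowerSeries.coeff_X] at h
  split_ifs at h with hα
  · rw [hα, timeWeight, weight_single]; simp
  · simp at h

/-- `⟨p| exp (∑ T_k J_k) |S⟩`. -/
def leftVector (p : ℤ) (S : Maya) : TimeRing :=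
  entries (vertexOp fun k => (MvPowerSeries.X (Sum.inl k) : TimeRing)) (Maya.vac p) S

/-- `⟨S| exp (-∑ T̄_k J_{-k}) |p⟩`. -/
def rightVector (p : ℤ) (S : Maya) : TimeRing :=
  entries (vertexOp fun k => -(MvPowerSeries.X (Sum.inr k) : TimeRing)) (Maya.vac p) S

lemma timeEvolution_eq (p : ℤ) (S : Maya) : timeEvolution (Maya.vac p) S = leftVector p S := by
  rw [timeEvolution, opExp_currentSum]; rfl

lemma timeEvolutionBar_eq (p : ℤ) (S : Maya) :
    timeEvolutionBar S (Maya.vac p) = rightVector p S := by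
  rw [timeEvolutionBar, opExp_currentSum_neg]; rfl

lemma timeBounded_leftVector (p : ℤ) : TimeBounded (Maya.vac p).energy (leftVector p) :=
  timeBounded_vertexOp (fun k α h => by rw [coeff_X_weight h]; rfl) _

lemma timeBounded_rightVector (p : ℤ) : TimeBounded (Maya.vac p).energy (rightVector p) :=
  timeBounded_vertexOp (fun k α h => by
    rw [map_neg, neg_ne_zero] at h
    rw [coeff_X_weight h]; rfl) _

lemma pderiv_leftVector (p : ℤ) (K : ℕ+) (S : Maya) :
    MvPowerSeries.pderiv ℝ (Sum.inl K) (leftVector p S) =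
      ∑' W, leftVector p W * algebraMap ℝ TimeRing (J K W S) := by
  classical
  have := pderiv_vertexOp (c := fun k => (MvPowerSeries.X (Sum.inl k) : TimeRing))
    (i := Sum.inl K) (K := K) (a := 1) (fun k => by
      rw [MvPowerSeries.pderiv_X, Pi.single_apply]; simp [eq_comm]) (Maya.vac p) S
  rwa [map_one, one_mul] at this

lemma pderiv_inr_leftVector (p : ℤ) (K : ℕ+) (S : Maya) :
    MvPowerSeries.pderiv ℝ (Sum.inr K) (leftVector p S) = 0 := by
  classical
  have := pderiv_vertexOp (c := fun k => (MvPowerSeries.X (Sum.inl k) : TimeRing))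
    (i := Sum.inr K) (K := K) (a := 0) (fun k => by
      rw [MvPowerSeries.pderiv_X, Pi.single_apply]; simp) (Maya.vac p) S
  rwa [map_zero, zero_mul] at this

lemma pderiv_rightVector (p : ℤ) (K : ℕ+) (S : Maya) :
    MvPowerSeries.pderiv ℝ (Sum.inr K) (rightVector p S) =
      -∑' W, rightVector p W * algebraMap ℝ TimeRing (J K W S) := by
  classical
  have := pderiv_vertexOp (c := fun k => -(MvPowerSeries.X (Sum.inr k) : TimeRing))
    (i := Sum.inr K) (K := K) (a := -1) (fun k => by
      rw [map_neg, MvPowerSeries.pderiv_X, Pi.single_apply]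
      by_cases h : k = K <;> simp [h]) (Maya.vac p) S
  rwa [map_neg, map_one, neg_one_mul] at this

lemma pderiv_inl_rightVector (p : ℤ) (K : ℕ+) (S : Maya) :
    MvPowerSeries.pderiv ℝ (Sum.inl K) (rightVector p S) = 0 := by
  classical
  have := pderiv_vertexOp (c := fun k => -(MvPowerSeries.X (Sum.inr k) : TimeRing))
    (i := Sum.inl K) (K := K) (a := 0) (fun k => by
      rw [map_neg, MvPowerSeries.pderiv_X, Pi.single_apply]; simp) (Maya.vac p) S
  rwa [map_zero, zero_mul] at this

lemma tauConverges (g : Matrix Maya Maya ℝ) (p : ℤ) : TauConverges g p := by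
  refine ⟨currentSummable_one _, currentSummable_neg_one _, exponentiable_currentSum _,
    exponentiable_currentSum_neg _, fun S => ?_, ?_⟩
  · simp only [timeEvolutionBar_eq, Matrix.map_apply]
    exact summable_right (timeBounded_rightVector p) g S
  · simp only [timeEvolution_eq]
    exact summable_left (timeBounded_leftVector p) _

lemma tau_eq_sandwich (g : Matrix Maya Maya ℝ) (p : ℤ) :
    tau g p = sandwich (leftVector p) (rightVector p) g := by
  rw [← sandwich_eq_iterated (timeBounded_leftVector p) (timeBounded_rightVector p), tau, opMul]
  simp only [opMul, timeEvolution_eq, timeEvolutionBar_eq, Matrix.map_apply]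

lemma pderiv_inl_tau (g : Matrix Maya Maya ℝ) (p : ℤ) (K : ℕ+) :
    MvPowerSeries.pderiv ℝ (Sum.inl K) (tau g p) =
      sandwich (leftVector p) (rightVector p) (opMul (J K) g) := by
  have ha := timeBounded_leftVector p
  have hb := timeBounded_rightVector p
  rw [tau_eq_sandwich, sandwich,
    ← (hasSum_pderiv (summable_sandwich ha hb g).hasSum (Sum.inl K)).tsum_eq]
  refine Eq.trans (tsum_congr fun x => ?_) (sandwich_current ha hb g K)
  rw [← pderiv_leftVector, Derivation.leibniz, pderiv_algebraMap_mul,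
    pderiv_inl_rightVector]
  simp [mul_comm]

lemma pderiv_inr_tau (g : Matrix Maya Maya ℝ) (p : ℤ) (K : ℕ+) :
    MvPowerSeries.pderiv ℝ (Sum.inr K) (tau g p) =
      -sandwich (leftVector p) (rightVector p) (opMul g (J (-K))) := by
  have ha := timeBounded_leftVector p
  have hb := timeBounded_rightVector p
  have hJ : opMul g (J (-K)) = (opMul (J K) g.transpose).transpose := by
    rw [← opMul_transpose]
    congr 1
    ext S U
    exact J_transpose _ _ _
  rw [hJ, sandwich_transpose, ← sandwich_current hb ha, ← tsum_neg, tau_eq_sandwich,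
    ← sandwich_transpose, sandwich,
    ← (hasSum_pderiv (summable_sandwich hb ha g.transpose).hasSum (Sum.inr K)).tsum_eq]
  refine tsum_congr fun x => ?_
  rw [← neg_mul, ← pderiv_rightVector, Derivation.leibniz, pderiv_algebraMap_mul,
    pderiv_inr_leftVector]
  simp [mul_comm]

end MeltingCrystalProof

theorem theorem2 (q q₁ q₂ Q : ℝ) (N₁ N₂ : ℕ+)
    (hq0 : 0 < q) (hq1 : q < 1)
    (hq₁ : q₁ = q ^ (1 / (N₁ : ℝ))) (hq₂ : q₂ = q ^ (1 / (N₂ : ℝ)))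
    (hQ : 0 < Q) (hconv : Q * Real.sqrt (q₁ * q₂) < 1) :
    GElementConverges q₁ q₂ Q ∧
    (∀ k : ℕ+,
      Composable (J ((N₁ * k : ℕ+) : ℤ)) (gElement q₁ q₂ Q) ∧
      Composable (gElement q₁ q₂ Q) (J (-((N₂ * k : ℕ+) : ℤ))) ∧
      (-1 : ℝ) ^ ((N₁ * k : ℕ+) : ℕ) • opMul (J ((N₁ * k : ℕ+) : ℤ)) (gElement q₁ q₂ Q) =
        (-1 : ℝ) ^ ((N₂ * k : ℕ+) : ℕ) •
          opMul (gElement q₁ q₂ Q) (J (-((N₂ * k : ℕ+) : ℤ)))) ∧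
    (∀ p : ℤ,
      TauConverges (gElement q₁ q₂ Q) p ∧
      ∀ k : ℕ+,
        (-1 : ℝ) ^ ((N₁ * k : ℕ+) : ℕ) •
            MvPowerSeries.pderiv ℝ (Sum.inl (N₁ * k)) (tau (gElement q₁ q₂ Q) p) +
          (-1 : ℝ) ^ ((N₂ * k : ℕ+) : ℕ) •
            MvPowerSeries.pderiv ℝ (Sum.inr (N₂ * k)) (tau (gElement q₁ q₂ Q) p) = 0) := by
  -- with square roots of `q₁` and `q₂` all exponents become integral
  have hroot : ∀ (x : ℝ) (N : ℕ+), x = q ^ (1 / (N : ℝ)) →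
      ∃ r, 0 < r ∧ r < 1 ∧ x = r ^ 2 ∧ ∀ k : ℕ+, (r ^ ((N * k : ℕ+) : ℕ)) ^ 2 = q ^ (k : ℕ) := by
    intro x N hx
    have hN : (0 : ℝ) < N := by exact_mod_cast N.pos
    have hx0 : 0 < x := hx ▸ Real.rpow_pos_of_pos hq0 _
    have hx1 : x < 1 := hx ▸ Real.rpow_lt_one hq0.le hq1 (by positivity)
    refine ⟨√x, Real.sqrt_pos.2 hx0, ?_, (Real.sq_sqrt hx0.le).symm, fun k => ?_⟩
    · rw [Real.sqrt_lt' one_pos]; simpa using hx1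
    · rw [← pow_mul, mul_comm, pow_mul, Real.sq_sqrt hx0.le, hx, PNat.mul_coe, pow_mul,
        ← Real.rpow_natCast (q ^ (1 / (N : ℝ))), ← Real.rpow_mul hq0.le, one_div,
        inv_mul_cancel₀ hN.ne', Real.rpow_one]
  obtain ⟨r₁, h₁, h₁', e₁, hk₁⟩ := hroot q₁ N₁ hq₁
  obtain ⟨r₂, h₂, h₂', e₂, hk₂⟩ := hroot q₂ N₂ hq₂
  have hconv' : Q * (r₁ * r₂) < 1 := by
    rwa [e₁, e₂, ← mul_pow, Real.sqrt_sq (mul_pos h₁ h₂).le] at hconv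
  rw [e₁, e₂]
  have hJ : ∀ k : ℕ+, _ := fun k => J_gElement h₁ h₁' h₂ h₂' hQ hconv' (N₁ * k).pos (N₂ * k).pos
    ((hk₁ k).trans (hk₂ k).symm)
  refine ⟨gElementConverges h₁ h₁' h₂ h₂' hQ hconv', fun k =>
    ⟨composable_J_left _ _, composable_J_right _ _, hJ k⟩, fun p => ⟨tauConverges _ p, fun k => ?_⟩⟩
  rw [pderiv_inl_tau, pderiv_inr_tau, smul_neg,
    ← sandwich_smul _ _ (timeBounded_leftVector p) (timeBounded_rightVector p),
    ← sandwich_smul _ _ (timeBounded_leftVector p) (timeBounded_rightVector p), hJ k,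
    add_neg_cancel]
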